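/- Repeated bilateral trade with two-bit feedback, against a $\sigma$-smooth adversary. Let $\mathcal U=\{(p,q)\in[0,1]^2 : p\le q\}$. In each round $t=1,\dots,T$ the adversary privately chooses a $\sigma$-smooth probability distribution on $[0,1]^2$, i.e. a distribution $\mu$ with $\mu(A)\le \lambda(A)/\sigma$ for every measurable $A\subseteq[0,1]^2$, where $\lambda$ is the uniform distribution on $[0,1]^2$; the choice may depend on the valuations and on the internal randomization of the learner in the previous rounds. The valuations $(S_t,B_t)$ of the seller and of the buyer are drawn from it. The learner, who does not see them, posts a pair of prices $(P_t,Q_t)\in\mathcal U$, which may depend on its own randomization and on the feedback of the previous rounds, and then receives the two-bit feedback $(\mathbb I\{S_t\le P_t\},\mathbb I\{Q_t\le B_t\})$. The gain from trade is $\mathrm{GFT}_t(p,q)=\big((B_t-q)+(p-S_t)\big)\,\mathbb I\{S_t\le p\le q\le B_t\}$. The regret of an algorithm $\mathcal A$ against an adversary $\mathcal S$ is $$R_T(\mathcal A,\mathcal S)=\max_{(p,q)\in\mathcal U}\mathbb E\Big[\sum_{t=1}^T\mathrm{GFT}_t(p,q)-\sum_{t=1}^T\mathrm{GFT}_t(P_t,Q_t)\Big],$$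 and $R_T(\mathcal A)$ is the supremum of $R_T(\mathcal A,\mathcal S)$ over all $\sigma$-smooth adversaries $\mathcal S$. Theorem. Let $0<\sigma\le\frac19$ and $T\ge 8008$. Every (possibly randomized) learning algorithm $\mathcal A$ that posts two prices per round and receives two-bit feedback satisfies $$R_T(\mathcal A)\ \ge\ \frac1{50^3}\,T^{3/4}.$$ Moreover, the bound is already forced by i.i.d. adversaries: for every such $\mathcal A$ there is a $\sigma$-smooth probability distribution $\mu$ on $[0,1]^2$ such that the adversary $\mathcal S$ that draws $(S_1,B_1),(S_2,B_2),\dots$ i.i.d. from $\mu$, regardless of what the learner does, satisfies $R_T(\mathcal A,\mathcal S)\ge\frac1{50^3}\,T^{3/4}$. -/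

import Mathlib

open MeasureTheory ProbabilityTheory

namespace BilateralTrade

/-- A pair of valuations `(s, b) ∈ [0,1]²` of the seller and of the buyer. -/
abbrev Valuations : Type := unitInterval × unitInterval

/-- The upper triangle `{(p, q) ∈ [0,1]² | p ≤ q}`: `p` is posted to the seller, `q` to the
buyer. -/
abbrev Prices : Type := {x : unitInterval × unitInterval // x.1 ≤ x.2}

open Classical in
/-- The gain from trade `((b - q) + (p - s)) · 𝕀{s ≤ p ≤ q ≤ b}`. -/
noncomputable def GFT (x : Prices) (v : Valuations) : ℝ :=
  if v.1 ≤ x.1.1 ∧ x.1.1 ≤ x.1.2 ∧ x.1.2 ≤ v.2 then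
    ((v.2 : ℝ) - (x.1.2 : ℝ)) + ((x.1.1 : ℝ) - (v.1 : ℝ))
  else 0

open Classical in
/-- The two-bit feedback `(𝕀{s ≤ p}, 𝕀{q ≤ b})`. -/
noncomputable def twoBit (x : Prices) (v : Valuations) : Bool × Bool :=
  (decide (v.1 ≤ x.1.1), decide (x.1.2 ≤ v.2))

/-- A measure on `[0,1]²` is `σ`-smooth if `μ(A) ≤ ν(A) / σ` for all measurable `A`, where `ν`
is the uniform distribution on `[0,1]²`. -/
def IsSmooth (σ : ℝ) (μ : Measure Valuations) : Prop :=
  ∀ A : Set Valuations, MeasurableSet A → μ A ≤ volume A / ENNReal.ofReal σ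

/-- A randomized learning algorithm that posts two prices per round on the basis of two-bit
feedback. In each round it draws a fresh random seed in an arbitrary probability space
`(Θ, seedLaw)`. Rounds are numbered `0, 1, 2, …`; the prices of round `t` are a measurable
function of the seeds of the rounds `0, …, t` and of the feedback of the rounds `0, …, t - 1`. -/
structure Algorithm (Θ : Type*) [MeasurableSpace Θ] where
  /-- The law of the seed of a round. -/
  seedLaw : Measure Θ
  isProbabilityMeasure_seedLaw : IsProbabilityMeasure seedLaw
  /-- The prices of round `t`, given the seeds so far and the past feedback. -/
  price : (t : ℕ) → (Fin (t + 1) → Θ) → (Fin t → Bool × Bool) → Prices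
  measurable_price : ∀ t, Measurable fun h : (Fin (t + 1) → Θ) × (Fin t → Bool × Bool) =>
    price t h.1 h.2

/-- An adaptive `σ`-smooth adversary: the distribution of the valuations of round `t` may depend
on the valuations and on the internal randomization of the algorithm in the rounds before `t`, and
is always a `σ`-smooth probability measure on `[0,1]²`. -/
structure Adversary (Θ : Type*) [MeasurableSpace Θ] (σ : ℝ) where
  /-- The distribution of the valuations of round `t`, given the past. -/
  choice : (t : ℕ) → Kernel (Fin t → Θ × Valuations) Valuations
  isMarkovKernel_choice : ∀ t, IsMarkovKernel (choice t)
  smooth : ∀ t h, IsSmooth σ (choice t h)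

/-- The i.i.d. adversary: in every round the valuations are drawn from the same distribution `μ`,
independently of the past. -/
noncomputable def Adversary.iid {Θ : Type*} [MeasurableSpace Θ] {σ : ℝ} (μ : Measure Valuations)
    (hμ : IsProbabilityMeasure μ) (hs : IsSmooth σ μ) : Adversary Θ σ where
  choice _ := Kernel.const _ μ
  isMarkovKernel_choice _ := inferInstance
  smooth _ h := by simpa using hs

section Protocol

variable {Θ : Type*} [MeasurableSpace Θ]

/-- The feedback received in the rounds `0, …, t - 1`, as a function of the seeds and of the
valuations of these rounds. -/
noncomputable def Algorithm.feedback (A : Algorithm Θ) :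
    (t : ℕ) → (Fin t → Θ × Valuations) → (Fin t → Bool × Bool)
  | 0, _ => Fin.elim0
  | t + 1, h =>
    let z : Fin t → Bool × Bool := A.feedback t (fun i => h i.castSucc)
    Fin.snoc (α := fun _ => Bool × Bool) z
      (twoBit (A.price t (fun i => (h i).1) z) (h (Fin.last t)).2)

/-- The prices posted in round `t < T`, as a function of the seeds and of the valuations of the
rounds `0, …, T - 1`; only the seeds up to round `t` and the feedback before round `t` matter. -/
noncomputable def Algorithm.posted (A : Algorithm Θ) {T : ℕ} (h : Fin T → Θ × Valuations)
    (t : Fin T) : Prices :=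
  A.price t (fun i => (h (i.castLE t.isLt)).1)
    (A.feedback t (fun i => h (i.castLE t.isLt.le)))

/-- The joint law of the seeds and of the valuations of the first `T` rounds. Given the past, the
seed and the valuations of a round are independent, the seed with law `A.seedLaw` and the
valuations with the law chosen by the adversary. -/
noncomputable def jointLaw (A : Algorithm Θ) {σ : ℝ} (S : Adversary Θ σ) :
    (T : ℕ) → Measure (Fin T → Θ × Valuations)
  | 0 => Measure.dirac Fin.elim0
  | T + 1 =>
    (jointLaw A S T ⊗ₘ (Kernel.const _ A.seedLaw ×ₖ S.choice T)).map
      (fun x => Fin.snoc (α := fun _ => Θ × Valuations) x.1 x.2)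

/-- The regret of the algorithm `A` against the adversary `S` over `T` rounds:
`max_{(p,q)} 𝔼[∑ₜ GFTₜ(p,q) - ∑ₜ GFTₜ(Pₜ,Qₜ)]`. -/
noncomputable def regret (A : Algorithm Θ) {σ : ℝ} (S : Adversary Θ σ) (T : ℕ) : ℝ :=
  ⨆ x : Prices, ∫ h, ((∑ t : Fin T, GFT x (h t).2) - ∑ t : Fin T, GFT (A.posted h t) (h t).2)
    ∂(jointLaw A S T)

/-- The regret of the algorithm `A` over `T` rounds: the supremum of its regret over all
`σ`-smooth adversaries. -/
noncomputable def worstCaseRegret (A : Algorithm Θ) (σ : ℝ) (T : ℕ) : EReal :=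
  ⨆ S : Adversary Θ σ, (regret A S T : EReal)

end Protocol

end BilateralTrade

open MeasureTheory ProbabilityTheory
open scoped ENNReal NNReal

namespace BilateralTrade

/-! The hard instances are a base law and `K` small perturbations of it. The base density lives on
the band `s ≤ b ≤ s + 3/8` and on two opposite corners. The gain of a single price from a band in
the whole plane is invariant under translation along the diagonal, and for prices in `[3/8, 5/8]`
the unit square cuts nothing off; hence all these prices are optimal for the base law
(`integral_baseDensity_GFT_diag_le`).

Cut `(3/8, 1/2]` into `K` strips of width `2d`. The `k`-th perturbation subtracts the product of a
mean-zero square wave in `s` on strip `k` and one in `b` on `(5/8, 3/4]`. It raises the gain of the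
single price at the centre of the strip by `d/256`, and prices whose seller price is off the strip
fall short of that optimum by at least `d/512` (`perturbed_regret`). Each value of the two bits is a
product of an event on `s` and an event on `b`, so mean zero makes the perturbation invisible unless
`p` is in the strip and `q` in `(5/8, 3/4]` (`integral_perturbation_twoBit_of_notMem`). Such prices
leave a spread above `1/8`, which costs at least `1/128` per round on the corner `(0, 1)`
(`base_regret_informative`), while the relative entropy gained is at most `16 d²`
(`exists_likelihoodRatio`).

A change of measure on what the learner sees (`lintegral_jointLaw_eq_lintegral_likelihood`) and a
linearized Pinsker inequality bound how much more often strip `k` is played under the `k`-th law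
than under the base law (`integral_sum_posted_le_add`). Summing over the disjoint strips gives
`exists_exploration_tradeoff`. With `d = 1/(16K)` and `K` about `T^(1/4)`, either the expected
number of informative rounds under the base law exceeds `K³`, at cost `K³/128`, or some perturbed
law forces regret of order `dT`. Both are of order `T^(3/4)`. -/

/-! ### Bounds and measurability of gain and feedback -/

theorem GFT_nonneg (x : Prices) (v : Valuations) : 0 ≤ GFT x v := by
  unfold GFT
  split_ifs with h
  · have h1 : (v.1 : ℝ) ≤ x.1.1 := h.1
    have h2 : (x.1.2 : ℝ) ≤ v.2 := h.2.2
    linarith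
  · exact le_rfl

theorem GFT_le_one (x : Prices) (v : Valuations) : GFT x v ≤ 1 := by
  unfold GFT
  split_ifs with h
  · have h1 : (x.1.1 : ℝ) ≤ x.1.2 := h.2.1
    have h2 := v.2.2.2
    have h3 := v.1.2.1
    linarith
  · exact zero_le_one

theorem measurable_GFT : Measurable fun y : Prices × Valuations => GFT y.1 y.2 := by
  unfold GFT
  refine Measurable.ite ?_ (by fun_prop) measurable_const
  have h1 : MeasurableSet {y : Prices × Valuations | y.2.1 ≤ y.1.1.1} :=
    measurableSet_le (by fun_prop) (by fun_prop)
  have h2 : MeasurableSet {y : Prices × Valuations | y.1.1.1 ≤ y.1.1.2} :=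
    measurableSet_le (by fun_prop) (by fun_prop)
  have h3 : MeasurableSet {y : Prices × Valuations | y.1.1.2 ≤ y.2.2} :=
    measurableSet_le (by fun_prop) (by fun_prop)
  exact h1.inter (h2.inter h3)

theorem measurable_twoBit : Measurable fun y : Prices × Valuations => twoBit y.1 y.2 := by
  unfold twoBit
  refine Measurable.prodMk ?_ ?_
  · refine measurable_to_bool ?_
    have : MeasurableSet {y : Prices × Valuations | y.2.1 ≤ y.1.1.1} :=
      measurableSet_le (by fun_prop) (by fun_prop)
    convert this using 1
    ext y; simp
  · refine measurable_to_bool ?_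
    have : MeasurableSet {y : Prices × Valuations | y.1.1.2 ≤ y.2.2} :=
      measurableSet_le (by fun_prop) (by fun_prop)
    convert this using 1
    ext y; simp

theorem measurable_snoc {α : Type*} [MeasurableSpace α] (n : ℕ) :
    Measurable fun x : (Fin n → α) × α => (Fin.snoc (α := fun _ => α) x.1 x.2 : Fin (n + 1) → α) := by
  refine measurable_pi_lambda _ fun i => ?_
  refine Fin.lastCases ?_ (fun j => ?_) i
  · simpa using measurable_snd
  · simp only [Fin.snoc_castSucc]
    fun_prop

/-! ### Transcripts: the information available to the learner -/

section

variable {Θ : Type*} [MeasurableSpace Θ] (A : Algorithm Θ)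

/-- The seeds and the feedback of the first `T` rounds. -/
noncomputable def Algorithm.transcript {T : ℕ} (h : Fin T → Θ × Valuations) :
    (Fin T → Θ) × (Fin T → Bool × Bool) :=
  (fun i => (h i).1, A.feedback T h)

/-- The prices of the next round, given the transcript so far and the seed of that round. -/
noncomputable def Algorithm.nextPrice {T : ℕ} (τ : (Fin T → Θ) × (Fin T → Bool × Bool)) (θ : Θ) :
    Prices :=
  A.price T (Fin.snoc (α := fun _ => Θ) τ.1 θ) τ.2

/-- The transcript extended by one round in which the valuations are `y.2`. -/
noncomputable def Algorithm.extend {T : ℕ} (τ : (Fin T → Θ) × (Fin T → Bool × Bool)) (θ : Θ)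
    (z : Bool × Bool) : (Fin (T + 1) → Θ) × (Fin (T + 1) → Bool × Bool) :=
  (Fin.snoc (α := fun _ => Θ) τ.1 θ, Fin.snoc (α := fun _ => Bool × Bool) τ.2 z)

theorem Algorithm.measurable_nextPrice {T : ℕ} :
    Measurable fun y : ((Fin T → Θ) × (Fin T → Bool × Bool)) × Θ => A.nextPrice y.1 y.2 := by
  have h : Measurable fun y : ((Fin T → Θ) × (Fin T → Bool × Bool)) × Θ =>
      ((Fin.snoc (α := fun _ => Θ) y.1.1 y.2 : Fin (T + 1) → Θ), y.1.2) :=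
    ((measurable_snoc T).comp (by fun_prop : Measurable fun y :
      ((Fin T → Θ) × (Fin T → Bool × Bool)) × Θ => (y.1.1, y.2))).prodMk (by fun_prop)
  exact (A.measurable_price T).comp h

theorem measurable_extend {T : ℕ} :
    Measurable fun y : ((Fin T → Θ) × (Fin T → Bool × Bool)) × Θ × (Bool × Bool) =>
      Algorithm.extend y.1 y.2.1 y.2.2 :=
  ((measurable_snoc T).comp (by fun_prop : Measurable fun y :
      ((Fin T → Θ) × (Fin T → Bool × Bool)) × Θ × (Bool × Bool) => (y.1.1, y.2.1))).prodMk
    ((measurable_snoc T).comp (by fun_prop : Measurable fun y :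
      ((Fin T → Θ) × (Fin T → Bool × Bool)) × Θ × (Bool × Bool) => (y.1.2, y.2.2)))

theorem Algorithm.transcript_snoc {T : ℕ} (h : Fin T → Θ × Valuations) (y : Θ × Valuations) :
    A.transcript (Fin.snoc (α := fun _ => Θ × Valuations) h y) =
      Algorithm.extend (A.transcript h) y.1
        (twoBit (A.nextPrice (A.transcript h) y.1) y.2) := by
  have hs : (fun i => ((Fin.snoc (α := fun _ => Θ × Valuations) h y : Fin (T + 1) → _) i).1) =
      (Fin.snoc (α := fun _ => Θ) (fun i => (h i).1) y.1 : Fin (T + 1) → Θ) :=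
    Fin.comp_snoc (α := Θ × Valuations) Prod.fst h y
  simp only [Algorithm.transcript, Algorithm.extend, Algorithm.nextPrice, Algorithm.feedback,
    Fin.snoc_castSucc, Fin.snoc_last, hs]

theorem Algorithm.measurable_transcript (T : ℕ) :
    Measurable fun h : Fin T → Θ × Valuations => A.transcript h := by
  induction T with
  | zero => exact measurable_of_subsingleton_codomain _
  | succ T ih =>
    have h1 : (fun h : Fin (T + 1) → Θ × Valuations => A.transcript h) = fun h =>
        Algorithm.extend (A.transcript (Fin.init h)) (h (Fin.last T)).1
          (twoBit (A.nextPrice (A.transcript (Fin.init h)) (h (Fin.last T)).1)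
            (h (Fin.last T)).2) := by
      funext h
      rw [← A.transcript_snoc, Fin.snoc_init_self]
    have hi : Measurable fun h : Fin (T + 1) → Θ × Valuations => A.transcript (Fin.init h) :=
      ih.comp (measurable_pi_lambda _ fun i => measurable_pi_apply _)
    have hl : Measurable fun h : Fin (T + 1) → Θ × Valuations => h (Fin.last T) :=
      measurable_pi_apply _
    have hp : Measurable fun h : Fin (T + 1) → Θ × Valuations =>
        A.nextPrice (A.transcript (Fin.init h)) (h (Fin.last T)).1 :=
      A.measurable_nextPrice.comp (hi.prodMk hl.fst)
    rw [h1]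
    exact measurable_extend.comp (hi.prodMk (hl.fst.prodMk (measurable_twoBit.comp
      (hp.prodMk hl.snd))))

theorem Algorithm.feedback_castLE {t T : ℕ} (hT : t ≤ T) (h : Fin T → Θ × Valuations) :
    A.feedback t (fun i => h (i.castLE hT)) = fun i => A.feedback T h (i.castLE hT) := by
  induction T with
  | zero =>
    obtain rfl : t = 0 := by omega
    rfl
  | succ T ih =>
    rcases Nat.lt_or_eq_of_le hT with hlt | rfl
    · have := ih (Nat.lt_succ_iff.1 hlt) (fun i => h i.castSucc)
      have e : (fun i : Fin t => h (i.castLE hT)) =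
          fun i : Fin t => h (i.castLE (Nat.lt_succ_iff.1 hlt)).castSucc := rfl
      rw [e, this]
      funext i
      have e2 : i.castLE hT = (i.castLE (Nat.lt_succ_iff.1 hlt)).castSucc := rfl
      rw [e2]
      simp only [Algorithm.feedback, Fin.snoc_castSucc]
    · rfl

/-- The prices of round `t`, as a function of the transcript. -/
noncomputable def Algorithm.transcriptPrice {T : ℕ} (τ : (Fin T → Θ) × (Fin T → Bool × Bool))
    (t : Fin T) : Prices :=
  A.price t (fun i => τ.1 (i.castLE t.isLt)) (fun i => τ.2 (i.castLE t.isLt.le))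

/-- Valuations influence the prices only through the feedback. This is what lets price statistics be
compared by a change of measure that knows nothing of the valuations themselves. -/
theorem Algorithm.transcriptPrice_transcript {T : ℕ} (h : Fin T → Θ × Valuations) (t : Fin T) :
    A.transcriptPrice (A.transcript h) t = A.posted h t := by
  simp only [Algorithm.transcriptPrice, Algorithm.posted, Algorithm.transcript,
    A.feedback_castLE t.isLt.le]

theorem Algorithm.measurable_transcriptPrice {T : ℕ} (t : Fin T) :
    Measurable fun τ : (Fin T → Θ) × (Fin T → Bool × Bool) => A.transcriptPrice τ t := by
  have h : Measurable fun τ : (Fin T → Θ) × (Fin T → Bool × Bool) =>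
      ((fun i : Fin (t + 1) => τ.1 (i.castLE t.isLt)),
        (fun i : Fin t => τ.2 (i.castLE t.isLt.le))) :=
    (measurable_pi_lambda _ fun i => (measurable_pi_apply _).comp measurable_fst).prodMk
      (measurable_pi_lambda _ fun i => (measurable_pi_apply _).comp measurable_snd)
  exact (A.measurable_price t).comp h

theorem Algorithm.measurable_posted {T : ℕ} (t : Fin T) :
    Measurable fun h : Fin T → Θ × Valuations => A.posted h t := by
  simp only [← A.transcriptPrice_transcript]
  exact (A.measurable_transcriptPrice t).comp (A.measurable_transcript T)

theorem Algorithm.posted_snoc_castSucc {T : ℕ} (h : Fin T → Θ × Valuations) (y : Θ × Valuations)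
    (t : Fin T) :
    A.posted (Fin.snoc (α := fun _ => Θ × Valuations) h y) t.castSucc = A.posted h t := by
  have e : ∀ (n : ℕ) (hn : n ≤ T) (i : Fin n),
      (Fin.snoc (α := fun _ => Θ × Valuations) h y : Fin (T + 1) → _)
        (i.castLE (hn.trans T.le_succ)) = h (i.castLE hn) := by
    intro n hn i
    exact Fin.snoc_castSucc (α := fun _ => Θ × Valuations) y h (i.castLE hn)
  simp only [Algorithm.posted, Fin.val_castSucc]
  rw [show (fun i : Fin (t : ℕ) => (Fin.snoc (α := fun _ => Θ × Valuations) h y : Fin (T + 1) → _)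
      (i.castLE t.castSucc.isLt.le)) = fun i => h (i.castLE t.isLt.le) from
      funext fun i => e t t.isLt.le i,
    show (fun i : Fin ((t : ℕ) + 1) => ((Fin.snoc (α := fun _ => Θ × Valuations) h y :
      Fin (T + 1) → _) (i.castLE t.castSucc.isLt)).1) = fun i => (h (i.castLE t.isLt)).1 from
      funext fun i => congrArg Prod.fst (e (t + 1) t.isLt i)]

theorem Algorithm.posted_snoc_last {T : ℕ} (h : Fin T → Θ × Valuations) (y : Θ × Valuations) :
    A.posted (Fin.snoc (α := fun _ => Θ × Valuations) h y) (Fin.last T) =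
      A.nextPrice (A.transcript h) y.1 := by
  rw [← A.transcriptPrice_transcript, A.transcript_snoc]
  simp only [Algorithm.transcriptPrice, Algorithm.nextPrice, Algorithm.extend]
  congr 1
  funext i
  exact Fin.snoc_castSucc (α := fun _ => Bool × Bool) _ _ i

end

/-! ### The joint law under i.i.d. valuations -/

section

variable {Θ : Type*} [MeasurableSpace Θ] (A : Algorithm Θ)

section Iid

variable {σ : ℝ} (μ : Measure Valuations) (hμ : IsProbabilityMeasure μ) (hs : IsSmooth σ μ)

theorem isProbabilityMeasure_jointLaw (T : ℕ) :
    IsProbabilityMeasure (jointLaw A (Adversary.iid (σ := σ) μ hμ hs) T) := by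
  have := A.isProbabilityMeasure_seedLaw
  induction T with
  | zero => unfold jointLaw; infer_instance
  | succ T ih =>
    unfold jointLaw
    have : IsMarkovKernel ((Adversary.iid (Θ := Θ) (σ := σ) μ hμ hs).choice T) :=
      (Adversary.iid (Θ := Θ) (σ := σ) μ hμ hs).isMarkovKernel_choice T
    exact Measure.isProbabilityMeasure_map (measurable_snoc T).aemeasurable

theorem jointLaw_succ (T : ℕ) :
    jointLaw A (Adversary.iid (σ := σ) μ hμ hs) (T + 1) =
      ((jointLaw A (Adversary.iid (σ := σ) μ hμ hs) T).prod (A.seedLaw.prod μ)).map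
        (fun x => Fin.snoc (α := fun _ => Θ × Valuations) x.1 x.2) := by
  have := A.isProbabilityMeasure_seedLaw
  have := isProbabilityMeasure_jointLaw A μ hμ hs T
  have : jointLaw A (Adversary.iid (σ := σ) μ hμ hs) (T + 1) =
      ((jointLaw A (Adversary.iid (σ := σ) μ hμ hs) T) ⊗ₘ (Kernel.const _ A.seedLaw ×ₖ
        Kernel.const _ μ)).map
        (fun x => Fin.snoc (α := fun _ => Θ × Valuations) x.1 x.2) := rfl
  rw [this, Kernel.prod_const, Measure.compProd_const]

theorem lintegral_jointLaw_succ (T : ℕ) {f : (Fin (T + 1) → Θ × Valuations) → ℝ≥0∞}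
    (hf : Measurable f) :
    ∫⁻ h, f h ∂(jointLaw A (Adversary.iid (σ := σ) μ hμ hs) (T + 1)) =
      ∫⁻ h, ∫⁻ y, f (Fin.snoc (α := fun _ => Θ × Valuations) h y) ∂(A.seedLaw.prod μ)
        ∂(jointLaw A (Adversary.iid (σ := σ) μ hμ hs) T) := by
  have := A.isProbabilityMeasure_seedLaw
  have := isProbabilityMeasure_jointLaw A μ hμ hs T
  have hm := hf.comp (measurable_snoc (α := Θ × Valuations) T)
  simp only [Function.comp_def] at hm
  rw [jointLaw_succ, lintegral_map hf (measurable_snoc T), lintegral_prod _ hm.aemeasurable]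

theorem integral_jointLaw_succ (T : ℕ) {f : (Fin (T + 1) → Θ × Valuations) → ℝ}
    (hf : Measurable f) {C : ℝ} (hC : ∀ h, |f h| ≤ C) :
    ∫ h, f h ∂(jointLaw A (Adversary.iid (σ := σ) μ hμ hs) (T + 1)) =
      ∫ h, ∫ y, f (Fin.snoc (α := fun _ => Θ × Valuations) h y) ∂(A.seedLaw.prod μ)
        ∂(jointLaw A (Adversary.iid (σ := σ) μ hμ hs) T) := by
  have := A.isProbabilityMeasure_seedLaw
  have := isProbabilityMeasure_jointLaw A μ hμ hs T
  have hm := hf.comp (measurable_snoc (α := Θ × Valuations) T)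
  rw [jointLaw_succ, integral_map (measurable_snoc T).aemeasurable hf.aestronglyMeasurable,
    integral_prod]
  exact Integrable.of_bound hm.aestronglyMeasurable C (.of_forall fun x => hC _)

variable {A μ} in
theorem Algorithm.measurable_posted_valuations {T : ℕ} (t : Fin T) {d : Prices → Valuations → ℝ}
    (hd : Measurable fun y : Prices × Valuations => d y.1 y.2) :
    Measurable fun h : Fin T → Θ × Valuations => d (A.posted h t) (h t).2 :=
  hd.comp ((A.measurable_posted t).prodMk (measurable_pi_apply t).snd)

/-- The price of a round is a function of the past and of the current seed, hence independent of the
current valuations. Conditioning on past and seed therefore reduces each round to a fixed price,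
where the hypothesis applies. -/
theorem integral_sum_posted_nonneg {d : Prices → Valuations → ℝ}
    (hd : Measurable fun y : Prices × Valuations => d y.1 y.2) {C : ℝ} (hC : ∀ x v, |d x v| ≤ C)
    (h0 : ∀ x, 0 ≤ ∫ v, d x v ∂μ) (T : ℕ) :
    0 ≤ ∫ h, ∑ t : Fin T, d (A.posted h t) (h t).2
      ∂(jointLaw A (Adversary.iid (σ := σ) μ hμ hs) T) := by
  have := A.isProbabilityMeasure_seedLaw
  induction T with
  | zero => simp
  | succ T ih =>
    have := isProbabilityMeasure_jointLaw A μ hμ hs T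
    have hm : ∀ T, Measurable fun h : Fin T → Θ × Valuations =>
        ∑ t : Fin T, d (A.posted h t) (h t).2 := fun T =>
      Finset.measurable_sum _ fun t _ => Algorithm.measurable_posted_valuations t hd
    have hb : ∀ (T : ℕ) (h : Fin T → Θ × Valuations),
        |∑ t : Fin T, d (A.posted h t) (h t).2| ≤ T * C := fun T h =>
      (Finset.abs_sum_le_sum_abs _ _).trans
        ((Finset.sum_le_sum fun t _ => hC _ _).trans (by simp))
    rw [integral_jointLaw_succ A μ hμ hs T (hm _) (hb _)]
    simp only [Fin.sum_univ_castSucc, A.posted_snoc_castSucc, A.posted_snoc_last,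
      Fin.snoc_castSucc, Fin.snoc_last]
    have hn : Measurable fun y : (Fin T → Θ × Valuations) × (Θ × Valuations) =>
        d (A.nextPrice (A.transcript y.1) y.2.1) y.2.2 :=
      hd.comp ((A.measurable_nextPrice.comp (((A.measurable_transcript T).comp
        measurable_fst).prodMk measurable_snd.fst)).prodMk measurable_snd.snd)
    have hi : Integrable (fun y : (Fin T → Θ × Valuations) × (Θ × Valuations) =>
        d (A.nextPrice (A.transcript y.1) y.2.1) y.2.2)
        ((jointLaw A (Adversary.iid (σ := σ) μ hμ hs) T).prod (A.seedLaw.prod μ)) :=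
      .of_bound hn.aestronglyMeasurable C (.of_forall fun y => hC _ _)
    have hi' : ∀ h : Fin T → Θ × Valuations, Integrable (fun y : Θ × Valuations =>
        d (A.nextPrice (A.transcript h) y.1) y.2) (A.seedLaw.prod μ) := fun h =>
      .of_bound (hn.comp (measurable_prodMk_left (x := h))).aestronglyMeasurable C
        (.of_forall fun y => hC _ _)
    have he : ∀ h : Fin T → Θ × Valuations,
        ∫ y, (∑ t : Fin T, d (A.posted h t) (h t).2) + d (A.nextPrice (A.transcript h) y.1) y.2
          ∂(A.seedLaw.prod μ) = (∑ t : Fin T, d (A.posted h t) (h t).2) +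
        ∫ y, d (A.nextPrice (A.transcript h) y.1) y.2 ∂(A.seedLaw.prod μ) := fun h => by
      rw [integral_add (integrable_const _) (hi' h)]
      simp
    simp only [he]
    rw [integral_add (.of_bound (hm T).aestronglyMeasurable _ (.of_forall (hb T)))
      hi.integral_prod_left]
    refine add_nonneg ih (integral_nonneg fun h => ?_)
    simp only [Pi.zero_apply]
    rw [integral_prod _ (hi' h)]
    exact integral_nonneg fun θ => h0 (A.nextPrice (A.transcript h) θ)

theorem lintegral_comp_twoBit (x : Prices) (f : Bool × Bool → ℝ≥0∞) :
    ∫⁻ v, f (twoBit x v) ∂μ = ∑ z, f z * μ {v | twoBit x v = z} := by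
  have hx : Measurable (twoBit x) := measurable_twoBit.comp (measurable_const.prodMk measurable_id)
  rw [← lintegral_map (g := twoBit x) (f := f) .of_discrete hx, lintegral_fintype]
  refine Finset.sum_congr rfl fun z _ => ?_
  rw [Measure.map_apply hx (measurableSet_singleton z)]
  rfl

end Iid

/-! ### Change of measure on transcripts -/

/-- The likelihood ratio of a history, when `ℓ x z` is the likelihood ratio of the feedback `z` to
the prices `x`. -/
noncomputable def Algorithm.likelihood (ℓ : Prices → Bool × Bool → ℝ≥0) {T : ℕ}
    (h : Fin T → Θ × Valuations) : ℝ≥0 :=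
  ∏ t : Fin T, ℓ (A.posted h t) (twoBit (A.posted h t) (h t).2)

theorem Algorithm.measurable_likelihood {ℓ : Prices → Bool × Bool → ℝ≥0}
    (hℓ : Measurable fun y : Prices × (Bool × Bool) => ℓ y.1 y.2) {T : ℕ} :
    Measurable fun h : Fin T → Θ × Valuations => A.likelihood ℓ h := by
  refine Finset.measurable_prod _ fun t _ => hℓ.comp ((A.measurable_posted t).prodMk ?_)
  exact measurable_twoBit.comp ((A.measurable_posted t).prodMk (measurable_pi_apply t).snd)

theorem Algorithm.likelihood_snoc (ℓ : Prices → Bool × Bool → ℝ≥0) {T : ℕ}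
    (h : Fin T → Θ × Valuations) (y : Θ × Valuations) :
    A.likelihood ℓ (Fin.snoc (α := fun _ => Θ × Valuations) h y) =
      A.likelihood ℓ h * ℓ (A.nextPrice (A.transcript h) y.1)
        (twoBit (A.nextPrice (A.transcript h) y.1) y.2) := by
  simp only [Algorithm.likelihood, Fin.prod_univ_castSucc, A.posted_snoc_castSucc,
    A.posted_snoc_last, Fin.snoc_castSucc, Fin.snoc_last]

/-- Restricted to functions of the transcript because `ℓ` relates only the laws of the feedback, not
those of the valuations. In the induction, averaging out the last round leaves again a function of
the shorter transcript. -/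
theorem lintegral_jointLaw_eq_lintegral_likelihood {σ : ℝ} {μ₀ μ₁ : Measure Valuations}
    (hμ₀ : IsProbabilityMeasure μ₀) (hs₀ : IsSmooth σ μ₀)
    (hμ₁ : IsProbabilityMeasure μ₁) (hs₁ : IsSmooth σ μ₁)
    {ℓ : Prices → Bool × Bool → ℝ≥0} (hℓ : Measurable fun y : Prices × (Bool × Bool) => ℓ y.1 y.2)
    (h : ∀ x z, μ₁ {v | twoBit x v = z} = ℓ x z * μ₀ {v | twoBit x v = z}) (T : ℕ)
    {f : (Fin T → Θ) × (Fin T → Bool × Bool) → ℝ≥0∞} (hf : Measurable f) :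
    ∫⁻ h, f (A.transcript h) ∂(jointLaw A (Adversary.iid (σ := σ) μ₁ hμ₁ hs₁) T) =
      ∫⁻ h, A.likelihood ℓ h * f (A.transcript h)
        ∂(jointLaw A (Adversary.iid (σ := σ) μ₀ hμ₀ hs₀) T) := by
  have := A.isProbabilityMeasure_seedLaw
  induction T with
  | zero => simp [Algorithm.likelihood, jointLaw]
  | succ T ih =>
    have hz : Measurable fun y : ((Fin T → Θ) × (Fin T → Bool × Bool)) × (Θ × Valuations) =>
        twoBit (A.nextPrice y.1 y.2.1) y.2.2 :=
      measurable_twoBit.comp ((A.measurable_nextPrice.comp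
        (measurable_fst.prodMk measurable_snd.fst)).prodMk measurable_snd.snd)
    have hF : Measurable fun y : ((Fin T → Θ) × (Fin T → Bool × Bool)) × (Θ × Valuations) =>
        f (Algorithm.extend y.1 y.2.1 (twoBit (A.nextPrice y.1 y.2.1) y.2.2)) :=
      hf.comp (measurable_extend.comp (measurable_fst.prodMk (measurable_snd.fst.prodMk hz)))
    have hG : Measurable fun y : ((Fin T → Θ) × (Fin T → Bool × Bool)) × (Θ × Valuations) =>
        ℓ (A.nextPrice y.1 y.2.1) (twoBit (A.nextPrice y.1 y.2.1) y.2.2) :=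
      hℓ.comp ((A.measurable_nextPrice.comp (measurable_fst.prodMk measurable_snd.fst)).prodMk hz)
    have hft := hf.comp (A.measurable_transcript (T + 1))
    simp only [Function.comp_def] at hft
    have hlt : Measurable fun h : Fin (T + 1) → Θ × Valuations =>
        A.likelihood ℓ h * f (A.transcript h) :=
      (A.measurable_likelihood hℓ).coe_nnreal_ennreal.mul hft
    rw [lintegral_jointLaw_succ A μ₁ hμ₁ hs₁ T hft, lintegral_jointLaw_succ A μ₀ hμ₀ hs₀ T hlt]
    simp only [A.transcript_snoc, A.likelihood_snoc]
    rw [ih (f := fun τ => ∫⁻ y, f (Algorithm.extend τ y.1 (twoBit (A.nextPrice τ y.1) y.2))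
      ∂(A.seedLaw.prod μ₁)) hF.lintegral_prod_right']
    refine lintegral_congr fun h' => ?_
    have e1 := hF.comp (measurable_prodMk_left (x := A.transcript h'))
    have e2 := hG.comp (measurable_prodMk_left (x := A.transcript h'))
    simp only [Function.comp_def] at e1 e2
    have e3 : Measurable fun y : Θ × Valuations =>
        (ℓ (A.nextPrice (A.transcript h') y.1) (twoBit (A.nextPrice (A.transcript h') y.1) y.2) : ℝ≥0∞)
          * f (Algorithm.extend (A.transcript h') y.1
            (twoBit (A.nextPrice (A.transcript h') y.1) y.2)) := e2.coe_nnreal_ennreal.mul e1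
    simp only [ENNReal.coe_mul, mul_assoc]
    rw [lintegral_const_mul _ e3,
      lintegral_prod _ e1.aemeasurable, lintegral_prod _ e3.aemeasurable]
    congr 1
    refine lintegral_congr fun θ => ?_
    set x := A.nextPrice (A.transcript h') θ
    rw [lintegral_comp_twoBit μ₁ x (fun z => f (Algorithm.extend (A.transcript h') θ z)),
      lintegral_comp_twoBit μ₀ x (fun z => ℓ x z * f (Algorithm.extend (A.transcript h') θ z))]
    refine Finset.sum_congr rfl fun z _ => ?_
    rw [h]
    ring

end

/-! ### From likelihood ratios to regret -/

/-- A pointwise, linear substitute for Pinsker's inequality: for a likelihood ratio of mean one it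
gives total variation at most four times the relative entropy plus a constant. Being linear in the
entropy, it sums over the instances without Cauchy–Schwarz. With `s = √r`, the first term dominates
`4 (s - 1)²`, and `|s - 1| (s + 1) ≤ 4 (s - 1)² + (s + 1)² / 16` by AM–GM. -/
theorem abs_sub_one_le_sub_log {r : ℝ} (hr : 0 < r) :
    |r - 1| ≤ 4 * (r - 1 - Real.log r) + (r + 1) / 8 := by
  obtain ⟨s, hs, rfl⟩ : ∃ s : ℝ, 0 < s ∧ s ^ 2 = r := ⟨√r, Real.sqrt_pos.2 hr, Real.sq_sqrt hr.le⟩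
  have h := Real.log_le_sub_one_of_pos hs
  rw [Real.log_pow]
  push_cast
  rw [abs_le]
  constructor <;> nlinarith [sq_nonneg (8 * (s - 1) - (s + 1)), sq_nonneg (8 * (s - 1) + (s + 1)),
    sq_nonneg (s - 1)]

section

variable {Θ : Type*} [MeasurableSpace Θ] (A : Algorithm Θ) {σ : ℝ}

theorem Algorithm.measurable_sum_posted (T : ℕ) {g : Prices → ℝ} (hg : Measurable g) :
    Measurable fun h : Fin T → Θ × Valuations => ∑ t : Fin T, g (A.posted h t) :=
  Finset.measurable_sum _ fun t _ => hg.comp (A.measurable_posted t)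

theorem Algorithm.abs_sum_posted_le {T : ℕ} {g : Prices → Valuations → ℝ} {C : ℝ}
    (hC : ∀ x v, |g x v| ≤ C) (h : Fin T → Θ × Valuations) :
    |∑ t : Fin T, g (A.posted h t) (h t).2| ≤ T * C :=
  (Finset.abs_sum_le_sum_abs _ _).trans ((Finset.sum_le_sum fun t _ => hC _ _).trans (by simp))

theorem integrable_sum_posted {μ : Measure Valuations} (hμ : IsProbabilityMeasure μ)
    (hs : IsSmooth σ μ) {g : Prices → Valuations → ℝ}
    (hg : Measurable fun y : Prices × Valuations => g y.1 y.2) {C : ℝ}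
    (hC : ∀ x v, |g x v| ≤ C) (T : ℕ) :
    Integrable (fun h : Fin T → Θ × Valuations => ∑ t : Fin T, g (A.posted h t) (h t).2)
      (jointLaw A (Adversary.iid (σ := σ) μ hμ hs) T) := by
  have := isProbabilityMeasure_jointLaw A μ hμ hs T
  exact .of_bound (Finset.measurable_sum _ fun t _ =>
    Algorithm.measurable_posted_valuations t hg).aestronglyMeasurable _
      (.of_forall fun h => A.abs_sum_posted_le hC h)

theorem integral_sum_posted_le {μ : Measure Valuations} (hμ : IsProbabilityMeasure μ)
    (hs : IsSmooth σ μ) {g : Prices → Valuations → ℝ}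
    (hg : Measurable fun y : Prices × Valuations => g y.1 y.2) {C : ℝ}
    (hC : ∀ x v, |g x v| ≤ C) {a : Prices → ℝ} (ha : Measurable a) {C' : ℝ}
    (hC' : ∀ x, |a x| ≤ C') (hag : ∀ x, a x ≤ ∫ v, g x v ∂μ) (T : ℕ) :
    ∫ h, ∑ t : Fin T, a (A.posted h t) ∂(jointLaw A (Adversary.iid (σ := σ) μ hμ hs) T) ≤
      ∫ h, ∑ t : Fin T, g (A.posted h t) (h t).2
        ∂(jointLaw A (Adversary.iid (σ := σ) μ hμ hs) T) := by
  have h1 : ∀ x, Integrable (g x) μ := fun x =>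
    .of_bound (hg.comp measurable_prodMk_left).aestronglyMeasurable C (.of_forall (hC x))
  have h2 : Measurable fun y : Prices × Valuations => g y.1 y.2 - a y.1 :=
    hg.sub (ha.comp measurable_fst)
  have h3 := integral_sum_posted_nonneg A μ hμ hs (d := fun x v => g x v - a x) h2 (C := C + C')
    (fun x v => (abs_sub _ _).trans (add_le_add (hC x v) (hC' x)))
    (fun x => by
      rw [integral_sub (h1 x) (integrable_const _)]
      simpa using hag x) T
  simp only [Finset.sum_sub_distrib] at h3
  rw [integral_sub (integrable_sum_posted A hμ hs hg hC T)
    (integrable_sum_posted A hμ hs (g := fun x _ => a x) (ha.comp measurable_fst)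
      (fun x _ => hC' x) T)] at h3
  linarith

theorem abs_GFT_sub_le (x y : Prices) (v : Valuations) : |GFT x v - GFT y v| ≤ 1 := by
  rw [abs_le]
  constructor <;> linarith [GFT_nonneg x v, GFT_le_one x v, GFT_nonneg y v, GFT_le_one y v]

theorem integral_sum_posted_le_regret {μ : Measure Valuations} (hμ : IsProbabilityMeasure μ)
    (hs : IsSmooth σ μ) {a : Prices → ℝ} (ha : Measurable a) {C : ℝ}
    (hC : ∀ x, |a x| ≤ C) (x₀ : Prices) (hax : ∀ x, a x ≤ ∫ v, (GFT x₀ v - GFT x v) ∂μ) (T : ℕ) :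
    ∫ h, ∑ t : Fin T, a (A.posted h t) ∂(jointLaw A (Adversary.iid (σ := σ) μ hμ hs) T) ≤
      regret A (Adversary.iid (σ := σ) μ hμ hs) T := by
  have := isProbabilityMeasure_jointLaw A μ hμ hs T
  have hm : Measurable fun y : Prices × Valuations => GFT x₀ y.2 - GFT y.1 y.2 :=
    (measurable_GFT.comp (measurable_const.prodMk measurable_snd)).sub measurable_GFT
  refine (integral_sum_posted_le A hμ hs hm (fun x v => abs_GFT_sub_le x₀ x v) ha hC hax T).trans ?_
  unfold regret
  simp only [← Finset.sum_sub_distrib]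
  refine le_ciSup (f := fun x : Prices => ∫ h, ∑ t : Fin T,
    (GFT x (h t).2 - GFT (A.posted h t) (h t).2) ∂(jointLaw A (Adversary.iid (σ := σ) μ hμ hs) T))
    -- A real supremum is informative only when bounded above; per-round gain differences are at
    -- most one.
    ⟨T * 1, ?_⟩ x₀
  rintro _ ⟨x, rfl⟩
  refine (Real.le_norm_self _).trans ((norm_integral_le_of_norm_le_const (.of_forall fun h =>
    A.abs_sum_posted_le (fun y v => abs_GFT_sub_le x y v) h)).trans ?_)
  simp

/-- Write `S` for the sum of the `g`-values and `L` for the likelihood ratio. The expectation of `S`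
under `μ₁` is that of `L * S` under `μ₀`, and `L * S ≤ S + T |L - 1|`. The term `1 / 4` is the mean
of `(L + 1) / 8`; the expectation of `-log L` splits into rounds, each bounded by `κ`. The two-sided
bounds on `ℓ` serve integrability. -/
theorem integral_sum_posted_le_add {μ₀ μ₁ : Measure Valuations}
    (hμ₀ : IsProbabilityMeasure μ₀) (hs₀ : IsSmooth σ μ₀)
    (hμ₁ : IsProbabilityMeasure μ₁) (hs₁ : IsSmooth σ μ₁)
    {ℓ : Prices → Bool × Bool → ℝ≥0} (hℓ : Measurable fun y : Prices × (Bool × Bool) => ℓ y.1 y.2)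
    (hℓ₀ : ∀ x z, 1 / 2 ≤ ℓ x z) (hℓ₁ : ∀ x z, ℓ x z ≤ 2)
    (h : ∀ x z, μ₁ {v | twoBit x v = z} = ℓ x z * μ₀ {v | twoBit x v = z})
    {κ : Prices → ℝ} (hκ : Measurable κ) {C : ℝ} (hC : ∀ x, |κ x| ≤ C)
    (hκℓ : ∀ x, ∫ v, -Real.log (ℓ x (twoBit x v)) ∂μ₀ ≤ κ x)
    {g : Prices → ℝ} (hg : Measurable g) (hg₀ : ∀ x, 0 ≤ g x) (hg₁ : ∀ x, g x ≤ 1) (T : ℕ) :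
    ∫ h, ∑ t : Fin T, g (A.posted h t) ∂(jointLaw A (Adversary.iid (σ := σ) μ₁ hμ₁ hs₁) T) ≤
      ∫ h, ∑ t : Fin T, g (A.posted h t) ∂(jointLaw A (Adversary.iid (σ := σ) μ₀ hμ₀ hs₀) T) +
      T * (1 / 4 + 4 * ∫ h, ∑ t : Fin T, κ (A.posted h t)
        ∂(jointLaw A (Adversary.iid (σ := σ) μ₀ hμ₀ hs₀) T)) := by
  have := isProbabilityMeasure_jointLaw A μ₀ hμ₀ hs₀ T
  have := isProbabilityMeasure_jointLaw A μ₁ hμ₁ hs₁ T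
  set J₀ := jointLaw A (Adversary.iid (σ := σ) μ₀ hμ₀ hs₀) T
  set J₁ := jointLaw A (Adversary.iid (σ := σ) μ₁ hμ₁ hs₁) T
  set L : (Fin T → Θ × Valuations) → ℝ := fun h => A.likelihood ℓ h
  have hLm : Measurable L := (A.measurable_likelihood hℓ).coe_nnreal_real
  have hLp : ∀ h, 0 < L h := fun h => by
    have : 0 < A.likelihood ℓ h :=
      Finset.prod_pos fun t _ => lt_of_lt_of_le (by norm_num) (hℓ₀ _ _)
    exact_mod_cast this
  have hLi : Integrable L J₀ := by
    refine .of_bound hLm.aestronglyMeasurable (2 ^ T) (.of_forall fun h => ?_)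
    rw [Real.norm_of_nonneg (hLp h).le]
    have : A.likelihood ℓ h ≤ 2 ^ T := by
      refine (Finset.prod_le_pow_card _ _ 2 fun t _ => hℓ₁ _ _).trans ?_
      simp
    exact_mod_cast this
  have hL1 : ∫ h, L h ∂J₀ = 1 := by
    have := lintegral_jointLaw_eq_lintegral_likelihood A hμ₀ hs₀ hμ₁ hs₁ hℓ h T
      (f := fun _ => 1) measurable_const
    rw [integral_eq_lintegral_of_nonneg_ae (.of_forall fun h => (hLp h).le)
      hLm.aestronglyMeasurable]
    simp only [mul_one, lintegral_const, measure_univ] at this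
    simp [L, J₀, ← this]
  have hS0 : ∀ h : Fin T → Θ × Valuations, 0 ≤ ∑ t : Fin T, g (A.posted h t) := fun h =>
    Finset.sum_nonneg fun t _ => hg₀ _
  have hST : ∀ h : Fin T → Θ × Valuations, ∑ t : Fin T, g (A.posted h t) ≤ T := fun h =>
    (Finset.sum_le_sum fun t _ => hg₁ _).trans (by simp)
  have hSm := A.measurable_sum_posted T hg
  have hSi : Integrable (fun h : Fin T → Θ × Valuations => ∑ t : Fin T, g (A.posted h t)) J₀ :=
    .of_bound hSm.aestronglyMeasurable T
      (.of_forall fun h => by rw [Real.norm_of_nonneg (hS0 h)]; exact hST h)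
  have hLS : ∫ h, ∑ t : Fin T, g (A.posted h t) ∂J₁ =
      ∫ h, L h * ∑ t : Fin T, g (A.posted h t) ∂J₀ := by
    have e := lintegral_jointLaw_eq_lintegral_likelihood A hμ₀ hs₀ hμ₁ hs₁ hℓ h T
      (f := fun τ => ENNReal.ofReal (∑ t : Fin T, g (A.transcriptPrice τ t)))
      (Finset.measurable_sum _ fun t _ =>
        hg.comp (A.measurable_transcriptPrice t)).ennreal_ofReal
    simp only [A.transcriptPrice_transcript] at e
    rw [integral_eq_lintegral_of_nonneg_ae (.of_forall hS0) hSm.aestronglyMeasurable, e,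
      integral_eq_lintegral_of_nonneg_ae (.of_forall fun h => mul_nonneg (hLp h).le (hS0 h))
        (hLm.mul hSm).aestronglyMeasurable]
    congr 1
    refine lintegral_congr fun h => ?_
    rw [ENNReal.ofReal_mul (hLp h).le]
    simp [L]
  have hlog : ∀ h, -Real.log (L h) = ∑ t : Fin T,
      -Real.log (ℓ (A.posted h t) (twoBit (A.posted h t) (h t).2)) := fun h => by
    simp only [L, Algorithm.likelihood, NNReal.coe_prod]
    rw [Real.log_prod, Finset.sum_neg_distrib]
    intro t _
    have : 0 < ℓ (A.posted h t) (twoBit (A.posted h t) (h t).2) :=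
      lt_of_lt_of_le (by norm_num) (hℓ₀ _ _)
    exact_mod_cast this.ne'
  have hlb : ∀ x v, |-Real.log (ℓ x (twoBit x v))| ≤ 1 := fun x v => by
    have h1 : (1 / 2 : ℝ) ≤ ℓ x (twoBit x v) := by exact_mod_cast hℓ₀ x (twoBit x v)
    have h2 : (ℓ x (twoBit x v) : ℝ) ≤ 2 := by exact_mod_cast hℓ₁ x (twoBit x v)
    have h3 := Real.log_le_sub_one_of_pos (show (0 : ℝ) < ℓ x (twoBit x v) by linarith)
    have h4 := Real.one_sub_inv_le_log_of_pos (show (0 : ℝ) < ℓ x (twoBit x v) by linarith)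
    have h5 : (ℓ x (twoBit x v) : ℝ)⁻¹ ≤ 2 := by
      rw [inv_le_comm₀ (by linarith) (by norm_num)]; linarith
    rw [abs_neg, abs_le]
    constructor <;> linarith
  have hlm : Measurable fun y : Prices × Valuations => -Real.log (ℓ y.1 (twoBit y.1 y.2)) :=
    (hℓ.comp (measurable_fst.prodMk measurable_twoBit)).coe_nnreal_real.log.neg
  have hli : Integrable (fun h => -Real.log (L h)) J₀ := by
    simp only [hlog]
    exact integrable_sum_posted A hμ₀ hs₀ (g := fun x v => -Real.log (ℓ x (twoBit x v))) hlm hlb T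
  have hKL : ∫ h, -Real.log (L h) ∂J₀ ≤ ∫ h, ∑ t : Fin T, κ (A.posted h t) ∂J₀ := by
    simp only [hlog]
    have := integral_sum_posted_le A hμ₀ hs₀ (g := fun x v => -(-Real.log (ℓ x (twoBit x v))))
      hlm.neg (fun x v => by rw [abs_neg]; exact hlb x v) (a := fun x => -κ x) hκ.neg
      (fun x => by rw [abs_neg]; exact hC x)
      (fun x => by rw [integral_neg]; exact neg_le_neg (hκℓ x)) T
    simp only [Finset.sum_neg_distrib, integral_neg] at this ⊢
    linarith
  have hpt : ∀ h, L h * ∑ t : Fin T, g (A.posted h t) ≤ ∑ t : Fin T, g (A.posted h t) +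
      T * (4 * (L h - 1 + -Real.log (L h)) + (L h + 1) / 8) := fun h => by
    have h1 := abs_sub_one_le_sub_log (hLp h)
    have h2 : (L h - 1) * ∑ t : Fin T, g (A.posted h t) ≤ |L h - 1| * T :=
      (mul_le_mul_of_nonneg_right (le_abs_self _) (hS0 h)).trans
        (mul_le_mul_of_nonneg_left (hST h) (abs_nonneg _))
    have h3 : |L h - 1| * T ≤ (4 * (L h - 1 - Real.log (L h)) + (L h + 1) / 8) * T :=
      mul_le_mul_of_nonneg_right h1 (Nat.cast_nonneg _)
    linarith
  have hi0 : Integrable (fun h => L h - 1) J₀ := hLi.sub (integrable_const 1)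
  have hi1 : Integrable (fun h => L h - 1 + -Real.log (L h)) J₀ := hi0.add hli
  have hi2 : Integrable (fun h => (L h + 1) / 8) J₀ := (hLi.add (integrable_const 1)).div_const 8
  have hi3 : Integrable (fun h => T * (4 * (L h - 1 + -Real.log (L h)) + (L h + 1) / 8)) J₀ :=
    ((hi1.const_mul 4).add hi2).const_mul _
  rw [hLS]
  refine (integral_mono_of_nonneg (.of_forall fun h => mul_nonneg (hLp h).le (hS0 h))
    (hSi.add hi3) (.of_forall hpt)).trans ?_
  simp only [Pi.add_apply]
  rw [integral_add hSi hi3, integral_const_mul, integral_add (hi1.const_mul 4) hi2,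
    integral_const_mul, integral_add hi0 hli,
    integral_sub hLi (integrable_const 1), integral_div, integral_add hLi (integrable_const 1), hL1]
  simp only [integral_const, probReal_univ, smul_eq_mul, mul_one, sub_self, zero_add]
  have hT : (0 : ℝ) ≤ T := Nat.cast_nonneg T
  nlinarith [mul_le_mul_of_nonneg_left hKL hT]

end

/-! ### Exploration against identification -/

section

variable {Θ : Type*} [MeasurableSpace Θ] (A : Algorithm Θ) {σ : ℝ}

/-- The trade-off between exploration, which is costly when the valuations have law `μ₀`, and the
identification of the law `μ k`, which is only possible by posting prices in `info k`, and which is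
necessary for posting prices in `good k`. -/
theorem exists_exploration_tradeoff {K : ℕ} {μ₀ : Measure Valuations}
    (hμ₀ : IsProbabilityMeasure μ₀) (hs₀ : IsSmooth σ μ₀) {μ : Fin K → Measure Valuations}
    (hμ : ∀ k, IsProbabilityMeasure (μ k)) (hs : ∀ k, IsSmooth σ (μ k))
    {ℓ : Fin K → Prices → Bool × Bool → ℝ≥0}
    (hℓ : ∀ k, Measurable fun y : Prices × (Bool × Bool) => ℓ k y.1 y.2)
    (hℓ₀ : ∀ k x z, 1 / 2 ≤ ℓ k x z) (hℓ₁ : ∀ k x z, ℓ k x z ≤ 2)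
    (h : ∀ k x z, μ k {v | twoBit x v = z} = ℓ k x z * μ₀ {v | twoBit x v = z})
    {info good : Fin K → Set Prices} (hinfo : ∀ k, MeasurableSet (info k))
    (hgood : ∀ k, MeasurableSet (good k))
    (hdisj : ∀ x, ∑ k, (good k).indicator (1 : Prices → ℝ) x ≤ 1)
    {D : ℝ} (hD : 0 ≤ D) (hκ : ∀ k x, ∫ v, -Real.log (ℓ k x (twoBit x v)) ∂μ₀ ≤
      D * (info k).indicator (1 : Prices → ℝ) x)
    {c : ℝ} (hc : 0 ≤ c) (x₀ : Prices)
    (h₀ : ∀ x, c * ∑ k, (info k).indicator (1 : Prices → ℝ) x ≤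
      ∫ v, (GFT x₀ v - GFT x v) ∂μ₀)
    {Δ : ℝ} (hΔ : 0 ≤ Δ) (x₁ : Fin K → Prices)
    (h₁ : ∀ k x, Δ * (1 - (good k).indicator (1 : Prices → ℝ) x) ≤
      ∫ v, (GFT (x₁ k) v - GFT x v) ∂(μ k)) (T : ℕ) :
    ∃ N : ℝ, c * N ≤ regret A (Adversary.iid (σ := σ) μ₀ hμ₀ hs₀) T ∧
      Δ * T * (3 / 4 * K - 1 - 4 * D * N) ≤
        ∑ k, regret A (Adversary.iid (σ := σ) (μ k) (hμ k) (hs k)) T := by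
  have := isProbabilityMeasure_jointLaw A μ₀ hμ₀ hs₀ T
  set J₀ := jointLaw A (Adversary.iid (σ := σ) μ₀ hμ₀ hs₀) T
  have hind : ∀ {S : Set Prices}, MeasurableSet S →
      Measurable (S.indicator (1 : Prices → ℝ)) := fun hS => measurable_one.indicator hS
  have hind0 : ∀ (S : Set Prices) x, 0 ≤ S.indicator (1 : Prices → ℝ) x := fun S x =>
    Set.indicator_nonneg (fun _ _ => zero_le_one) x
  have hind1 : ∀ (S : Set Prices) x, S.indicator (1 : Prices → ℝ) x ≤ 1 := fun S x =>
    Set.indicator_le_self' (fun _ _ => zero_le_one) x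
  have hindabs : ∀ (S : Set Prices) x, |S.indicator (1 : Prices → ℝ) x| ≤ 1 := fun S x => by
    rw [abs_of_nonneg (hind0 S x)]; exact hind1 S x
  have hint : ∀ {S : Set Prices} {ν : Measure Valuations} (hν : IsProbabilityMeasure ν)
      (hsν : IsSmooth σ ν), MeasurableSet S → Integrable (fun h : Fin T → Θ × Valuations =>
        ∑ t : Fin T, S.indicator (1 : Prices → ℝ) (A.posted h t))
        (jointLaw A (Adversary.iid (σ := σ) ν hν hsν) T) := fun {S _} hν hsν hS =>
    integrable_sum_posted A hν hsν (g := fun x _ => S.indicator (1 : Prices → ℝ) x)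
      ((hind hS).comp measurable_fst) (fun x _ => hindabs S x) T
  -- `N` is the expected number of informative posts, summed over all `k`, under the base law.
  refine ⟨∑ k, ∫ h, ∑ t : Fin T, (info k).indicator (1 : Prices → ℝ) (A.posted h t) ∂J₀, ?_, ?_⟩
  · have := integral_sum_posted_le_regret A hμ₀ hs₀
      (a := fun x => c * ∑ k, (info k).indicator (1 : Prices → ℝ) x)
      ((Finset.measurable_sum _ fun k _ => hind (hinfo k)).const_mul c) (C := c * K)
      (fun x => by
        rw [abs_of_nonneg (mul_nonneg hc (Finset.sum_nonneg fun k _ => hind0 _ _))]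
        refine mul_le_mul_of_nonneg_left ?_ hc
        exact (Finset.sum_le_sum fun k _ => hind1 _ _).trans (by simp)) x₀ h₀ T
    refine le_trans (le_of_eq ?_) this
    rw [← integral_finsetSum _ fun k _ => hint hμ₀ hs₀ (hinfo k), ← integral_const_mul]
    refine integral_congr_ae (.of_forall fun h => ?_)
    simp only [← Finset.mul_sum]
    rw [Finset.sum_comm]
  · have hk : ∀ k, Δ * (T - (∫ h, ∑ t : Fin T, (good k).indicator (1 : Prices → ℝ)
        (A.posted h t) ∂J₀ + T * (1 / 4 + 4 * (D * ∫ h, ∑ t : Fin T,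
          (info k).indicator (1 : Prices → ℝ) (A.posted h t) ∂J₀)))) ≤
        regret A (Adversary.iid (σ := σ) (μ k) (hμ k) (hs k)) T := fun k => by
      have := isProbabilityMeasure_jointLaw A (μ k) (hμ k) (hs k) T
      have e1 := integral_sum_posted_le_regret A (hμ k) (hs k)
        (a := fun x => Δ * (1 - (good k).indicator (1 : Prices → ℝ) x))
        ((measurable_const.sub (hind (hgood k))).const_mul Δ) (C := Δ)
        (fun x => by
          rw [abs_of_nonneg (mul_nonneg hΔ (by linarith [hind1 (good k) x]))]
          exact mul_le_of_le_one_right hΔ (by linarith [hind0 (good k) x])) (x₁ k) (h₁ k) T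
      have e2 := integral_sum_posted_le_add A hμ₀ hs₀ (hμ k) (hs k) (hℓ k) (hℓ₀ k) (hℓ₁ k) (h k)
        (κ := fun x => D * (info k).indicator (1 : Prices → ℝ) x)
        ((hind (hinfo k)).const_mul D) (C := D)
        (fun x => by
          rw [abs_of_nonneg (mul_nonneg hD (hind0 _ _))]
          exact mul_le_of_le_one_right hD (hind1 _ _)) (hκ k) (hind (hgood k)) (hind0 _)
        (hind1 _) T
      simp only [← Finset.mul_sum, Finset.sum_sub_distrib, integral_const_mul] at e1 e2
      rw [integral_sub (integrable_const _) (hint (hμ k) (hs k) (hgood k))] at e1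
      simp only [Finset.sum_const, Finset.card_univ, Fintype.card_fin, nsmul_eq_mul, mul_one,
        integral_const, probReal_univ, smul_eq_mul, one_mul] at e1
      refine le_trans (mul_le_mul_of_nonneg_left ?_ hΔ) e1
      linarith
    refine le_trans ?_ (Finset.sum_le_sum fun k _ => hk k)
    -- All counts are taken under the same law `J₀`, so a round is good for at most one `k` and the
    -- counts add up to at most `T`, independently of `K`.
    have hG : ∑ k, ∫ h, ∑ t : Fin T, (good k).indicator (1 : Prices → ℝ) (A.posted h t) ∂J₀ ≤ T := by
      rw [← integral_finsetSum _ fun k _ => hint hμ₀ hs₀ (hgood k)]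
      have : ∀ h : Fin T → Θ × Valuations,
          ∑ k, ∑ t : Fin T, (good k).indicator (1 : Prices → ℝ) (A.posted h t) ≤ T := fun h => by
        rw [Finset.sum_comm]
        exact (Finset.sum_le_sum fun t _ => hdisj _).trans (by simp)
      refine (integral_mono_of_nonneg (.of_forall fun h => Finset.sum_nonneg fun k _ =>
        Finset.sum_nonneg fun t _ => hind0 _ _) (integrable_const (T : ℝ))
        (.of_forall this)).trans ?_
      simp
    rw [← Finset.mul_sum, mul_assoc]
    refine mul_le_mul_of_nonneg_left ?_ hΔ
    simp only [Finset.sum_sub_distrib, Finset.sum_add_distrib, ← Finset.mul_sum, Finset.sum_const,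
      Finset.card_univ, Fintype.card_fin, nsmul_eq_mul]
    linarith

end

/-! ### Likelihood ratios of the feedback -/

theorem measurable_twoBit_left (x : Prices) : Measurable (twoBit x) :=
  measurable_twoBit.comp measurable_prodMk_left

theorem measurableSet_twoBit_eq (x : Prices) (z : Bool × Bool) :
    MeasurableSet {v | twoBit x v = z} :=
  measurable_twoBit_left x (measurableSet_singleton z)

theorem integral_comp_twoBit (μ : Measure Valuations) [IsFiniteMeasure μ] (x : Prices)
    (f : Bool × Bool → ℝ) :
    ∫ v, f (twoBit x v) ∂μ = ∑ z, μ.real {v | twoBit x v = z} * f z := by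
  have hx := measurable_twoBit_left x
  rw [← integral_map (φ := twoBit x) (f := f) hx.aemeasurable
    (Measurable.of_discrete).aestronglyMeasurable, integral_fintype .of_finite]
  refine Finset.sum_congr rfl fun z _ => ?_
  rw [smul_eq_mul, map_measureReal_apply hx (measurableSet_singleton z)]
  rfl

theorem measurable_measure_twoBit (μ : Measure Valuations) [SFinite μ] :
    Measurable fun y : Prices × (Bool × Bool) => μ {v | twoBit y.1 v = y.2} := by
  have : MeasurableSet {u : (Prices × (Bool × Bool)) × Valuations |
      twoBit u.1.1 u.2 = u.1.2} :=
    measurableSet_eq_fun (measurable_twoBit.comp (measurable_fst.fst.prodMk measurable_snd))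
      measurable_fst.snd
  exact measurable_measure_prodMk_left this

theorem neg_log_one_add_le {u : ℝ} (hu : -(1 / 2) ≤ u) : -Real.log (1 + u) ≤ -u + 2 * u ^ 2 := by
  have h1 : 0 < 1 + u := by linarith
  have h2 := Real.one_sub_inv_le_log_of_pos h1
  have h3 : (1 + u)⁻¹ ≤ 1 - u + 2 * u ^ 2 := by
    rw [inv_le_iff_one_le_mul₀ h1]
    nlinarith [mul_nonneg (sq_nonneg u) (show 0 ≤ 1 + 2 * u by linarith)]
  linarith

/-- On `info` every outcome has base probability at least `1/32`, so the ratio is `1 + u` with `|u|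
≤ 32 ε ≤ 1/2`. In the relative entropy the linear terms cancel, both laws having total mass one, and
each of the four outcomes contributes at most `2 * 32 ε²`. -/
theorem exists_likelihoodRatio {μ₀ μ₁ : Measure Valuations} [IsProbabilityMeasure μ₀]
    [IsProbabilityMeasure μ₁] {info : Set Prices} (hinfo : MeasurableSet info) {ε : ℝ}
    (hε : ε ≤ 1 / 64)
    (hout : ∀ x ∉ info, ∀ z, μ₁.real {v | twoBit x v = z} = μ₀.real {v | twoBit x v = z})
    (hlow : ∀ x ∈ info, ∀ z, 1 / 32 ≤ μ₀.real {v | twoBit x v = z})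
    (hdiff : ∀ x ∈ info, ∀ z,
      |μ₁.real {v | twoBit x v = z} - μ₀.real {v | twoBit x v = z}| ≤ ε) :
    ∃ ℓ : Prices → Bool × Bool → ℝ≥0,
      (Measurable fun y : Prices × (Bool × Bool) => ℓ y.1 y.2) ∧
      (∀ x z, 1 / 2 ≤ ℓ x z) ∧ (∀ x z, ℓ x z ≤ 2) ∧
      (∀ x z, μ₁ {v | twoBit x v = z} = ℓ x z * μ₀ {v | twoBit x v = z}) ∧
      ∀ x, ∫ v, -Real.log (ℓ x (twoBit x v)) ∂μ₀ ≤
        256 * ε ^ 2 * info.indicator (1 : Prices → ℝ) x := by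
  classical
  -- Off `info` the laws agree but outcomes may have probability zero, so the ratio is set to one
  -- there rather than to a quotient.
  set ℓ : Prices → Bool × Bool → ℝ≥0 := fun x z =>
    if x ∈ info then (μ₁ {v | twoBit x v = z} / μ₀ {v | twoBit x v = z}).toNNReal else 1 with hℓdef
  have hr : ∀ x ∈ info, ∀ z, (ℓ x z : ℝ) = 1 +
      (μ₁.real {v | twoBit x v = z} - μ₀.real {v | twoBit x v = z}) /
        μ₀.real {v | twoBit x v = z} := fun x hx z => by
    have h0 := hlow x hx z
    have : μ₀.real {v | twoBit x v = z} ≠ 0 := by linarith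
    simp only [hℓdef, if_pos hx]
    rw [ENNReal.coe_toNNReal_eq_toReal, ENNReal.toReal_div]
    simp only [Measure.real] at this ⊢
    field_simp
    ring
  have hu : ∀ x ∈ info, ∀ z, |(μ₁.real {v | twoBit x v = z} - μ₀.real {v | twoBit x v = z}) /
      μ₀.real {v | twoBit x v = z}| ≤ 1 / 2 := fun x hx z => by
    have h0 := hlow x hx z
    rw [abs_div, abs_of_pos (show 0 < μ₀.real {v | twoBit x v = z} by linarith),
      div_le_iff₀ (by linarith)]
    linarith [hdiff x hx z]
  refine ⟨ℓ, ?_, fun x z => ?_, fun x z => ?_, fun x z => ?_, fun x => ?_⟩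
  · exact Measurable.ite (measurable_fst hinfo)
      ((measurable_measure_twoBit μ₁).div (measurable_measure_twoBit μ₀)).ennreal_toNNReal
      measurable_const
  · by_cases hx : x ∈ info
    · rw [← NNReal.coe_le_coe, hr x hx z]
      push_cast
      linarith [(abs_le.1 (hu x hx z)).1]
    · simp only [hℓdef, if_neg hx]
      rw [← NNReal.coe_le_coe]; norm_num
  · by_cases hx : x ∈ info
    · rw [← NNReal.coe_le_coe, hr x hx z]
      push_cast
      linarith [(abs_le.1 (hu x hx z)).2]
    · simp only [hℓdef, if_neg hx]
      rw [← NNReal.coe_le_coe]; norm_num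
  · rw [← ENNReal.toReal_eq_toReal_iff' (measure_ne_top _ _)
      (ENNReal.mul_ne_top ENNReal.coe_ne_top (measure_ne_top _ _)), ENNReal.toReal_mul,
      ENNReal.coe_toReal]
    change μ₁.real _ = _ * μ₀.real _
    by_cases hx : x ∈ info
    · have h0 := hlow x hx z
      have : μ₀.real {v | twoBit x v = z} ≠ 0 := by linarith
      rw [hr x hx z]
      field_simp
      ring
    · rw [hout x hx z]
      simp only [hℓdef, if_neg hx, NNReal.coe_one, one_mul]
  · by_cases hx : x ∈ info
    · have hsum : ∀ (μ : Measure Valuations) [IsProbabilityMeasure μ],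
          ∑ z, μ.real {v | twoBit x v = z} = 1 := fun μ _ => by
        have := integral_comp_twoBit μ x (fun _ => 1)
        simpa using this.symm
      rw [integral_comp_twoBit μ₀ x (fun z => -Real.log (ℓ x z)), Set.indicator_of_mem hx]
      have hterm : ∀ z, μ₀.real {v | twoBit x v = z} * -Real.log (ℓ x z) ≤
          -(μ₁.real {v | twoBit x v = z} - μ₀.real {v | twoBit x v = z}) + 64 * ε ^ 2 := fun z => by
        have h0 := hlow x hx z
        have h1 := neg_log_one_add_le (abs_le.1 (hu x hx z)).1
        have h2 := sq_le_sq.2 ((hdiff x hx z).trans (le_abs_self ε))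
        rw [hr x hx z]
        set a := μ₀.real {v | twoBit x v = z}
        set d := μ₁.real {v | twoBit x v = z} - a
        have ha : 0 < a := by linarith
        refine (mul_le_mul_of_nonneg_left h1 ha.le).trans ?_
        have e : a * (-(d / a) + 2 * (d / a) ^ 2) = -d + 2 * (d ^ 2 / a) := by
          field_simp
        have h3 : d ^ 2 / a ≤ 32 * ε ^ 2 := by
          rw [div_le_iff₀ ha]
          nlinarith [mul_nonneg (sq_nonneg ε) (show 0 ≤ 32 * a - 1 by linarith)]
        rw [e]
        linarith
      refine (Finset.sum_le_sum fun z _ => hterm z).trans ?_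
      rw [Finset.sum_add_distrib, Finset.sum_neg_distrib, Finset.sum_sub_distrib, hsum μ₁, hsum μ₀]
      simp
      linarith
    · rw [Set.indicator_of_notMem hx]
      simp only [hℓdef, if_neg hx]
      simp

/-! ### Square waves and their moments -/

/-- The square wave that is `1` on `(a, a + d]`, `-1` on `(a + d, a + 2 d]` and `0` elsewhere. -/
noncomputable def wave (a d x : ℝ) : ℝ :=
  (Set.Ioc a (a + d)).indicator 1 x - (Set.Ioc (a + d) (a + 2 * d)).indicator 1 x

theorem measurable_wave (a d : ℝ) : Measurable (wave a d) :=
  (measurable_one.indicator measurableSet_Ioc).sub (measurable_one.indicator measurableSet_Ioc)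

theorem wave_of_notMem {a d x : ℝ} (hd : 0 ≤ d) (hx : x ∉ Set.Ioc a (a + 2 * d)) :
    wave a d x = 0 := by
  rw [wave, Set.indicator_of_notMem, Set.indicator_of_notMem, sub_zero]
  · exact fun h => hx ⟨by linarith [h.1], h.2⟩
  · exact fun h => hx ⟨h.1, by linarith [h.2]⟩

theorem abs_wave_le (a d x : ℝ) : |wave a d x| ≤ 1 := by
  have h1 : ∀ S : Set ℝ, 0 ≤ S.indicator (1 : ℝ → ℝ) x := fun S =>
    Set.indicator_nonneg (fun _ _ => zero_le_one) x
  have h2 : ∀ S : Set ℝ, S.indicator (1 : ℝ → ℝ) x ≤ 1 := fun S =>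
    Set.indicator_le_self' (fun _ _ => zero_le_one) x
  rw [wave, abs_le]
  constructor <;> linarith [h1 (Set.Ioc a (a + d)), h1 (Set.Ioc (a + d) (a + 2 * d)),
    h2 (Set.Ioc a (a + d)), h2 (Set.Ioc (a + d) (a + 2 * d))]

theorem integral_indicator_Ioc {u v : ℝ} (hu : 0 ≤ u) (huv : u ≤ v) (hv : v ≤ 1) (g : ℝ → ℝ) :
    ∫ s : unitInterval, (Set.Ioc u v).indicator g s = ∫ x in u..v, g x := by
  rw [unitInterval.measurePreserving_coe.integral_comp unitInterval.measurableEmbedding_coe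
    ((Set.Ioc u v).indicator g), setIntegral_indicator measurableSet_Ioc,
    intervalIntegral.integral_of_le huv]
  congr 2
  exact Set.inter_eq_right.2 fun x hx => ⟨hu.trans hx.1.le, hx.2.trans hv⟩

theorem integrable_indicator_Ioc {g : ℝ → ℝ} (hg : Continuous g) (u v : ℝ) :
    Integrable fun s : unitInterval => (Set.Ioc u v).indicator g s := by
  have h1 : Integrable fun s : unitInterval => g s :=
    (hg.comp continuous_subtype_val).integrable_of_hasCompactSupport
      (HasCompactSupport.of_compactSpace _)
  have h2 : (fun s : unitInterval => (Set.Ioc u v).indicator g s) =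
      ((↑) ⁻¹' Set.Ioc u v : Set unitInterval).indicator fun s => g s := by
    funext s
    simp [Set.indicator]
  rw [h2]
  exact h1.indicator (measurable_subtype_coe measurableSet_Ioc)

theorem integral_wave_mul {a d : ℝ} (ha : 0 ≤ a) (hd : 0 ≤ d) (had : a + 2 * d ≤ 1)
    {f : unitInterval → ℝ} {g : ℝ → ℝ} (hg : Continuous g) {c : ℝ}
    (h : ∀ s : unitInterval, (s : ℝ) ∈ Set.Ioc a (a + 2 * d) → f s = c * g s) :
    ∫ s : unitInterval, wave a d s * f s =
      c * ((∫ x in a..a + d, g x) - ∫ x in (a + d)..(a + 2 * d), g x) := by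
  have e : ∀ s : unitInterval, wave a d s * f s = c * ((Set.Ioc a (a + d)).indicator g s -
      (Set.Ioc (a + d) (a + 2 * d)).indicator g s) := fun s => by
    by_cases hs : (s : ℝ) ∈ Set.Ioc a (a + 2 * d)
    · rw [h s hs, wave]
      simp only [Set.indicator, Pi.one_apply]
      split_ifs <;> ring
    · rw [wave_of_notMem hd hs, Set.indicator_of_notMem, Set.indicator_of_notMem]
      · ring
      · exact fun h => hs ⟨by linarith [h.1], h.2⟩
      · exact fun h => hs ⟨h.1, by linarith [h.2]⟩
  simp only [e]
  rw [integral_const_mul, integral_sub (integrable_indicator_Ioc hg _ _)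
    (integrable_indicator_Ioc hg _ _), integral_indicator_Ioc ha (by linarith) (by linarith),
    integral_indicator_Ioc (by linarith) (by linarith) had]

/-- The two halves of the wave have equal length and opposite sign. -/
theorem integral_wave_mul_const {a d : ℝ} (ha : 0 ≤ a) (hd : 0 ≤ d) (had : a + 2 * d ≤ 1)
    {f : unitInterval → ℝ} {c : ℝ}
    (h : ∀ s : unitInterval, (s : ℝ) ∈ Set.Ioc a (a + 2 * d) → f s = c) :
    ∫ s : unitInterval, wave a d s * f s = 0 := by
  rw [integral_wave_mul ha hd had (g := fun _ => 1) continuous_const (c := c)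
    (fun s hs => by rw [h s hs, mul_one])]
  simp only [intervalIntegral.integral_const, smul_eq_mul]
  ring

/-- The negative half is the positive half shifted right by `d`, which costs `d` over a length `d`.
-/
theorem integral_wave_mul_linear {a d : ℝ} (ha : 0 ≤ a) (hd : 0 ≤ d) (had : a + 2 * d ≤ 1)
    {f : unitInterval → ℝ} {c : ℝ}
    (h : ∀ s : unitInterval, (s : ℝ) ∈ Set.Ioc a (a + 2 * d) → f s = c * s) :
    ∫ s : unitInterval, wave a d s * f s = -(c * d ^ 2) := by
  rw [integral_wave_mul ha hd had (g := fun x => x) continuous_id (c := c) h, integral_id,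
    integral_id]
  ring

theorem integral_wave_mul_le {a d : ℝ} (ha : 0 ≤ a) (hd : 0 ≤ d) (had : a + 2 * d ≤ 1)
    {f : unitInterval → ℝ} (hf : Measurable f) (hf₀ : ∀ s, 0 ≤ f s)
    (hf₁ : ∀ s, f s ≤ 1) :
    ∫ s : unitInterval, wave a d s * f s ≤ d := by
  have hi : Integrable fun s : unitInterval => wave a d s * f s :=
    .of_bound (((measurable_wave a d).comp measurable_subtype_coe).mul hf).aestronglyMeasurable 1
      (.of_forall fun s => by
        rw [norm_mul]
        exact mul_le_one₀ (abs_wave_le _ _ _) (norm_nonneg _)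
          (by rw [Real.norm_of_nonneg (hf₀ s)]; exact hf₁ s))
  calc ∫ s : unitInterval, wave a d s * f s
      ≤ ∫ s : unitInterval, (Set.Ioc a (a + d)).indicator (fun _ => 1) (s : ℝ) := by
        refine integral_mono hi (integrable_indicator_Ioc continuous_const _ _) fun s => ?_
        simp only [wave, Set.indicator, Pi.one_apply]
        split_ifs <;> linarith [hf₀ s, hf₁ s]
    _ = d := by
        rw [integral_indicator_Ioc ha (by linarith) (by linarith)]
        simp

theorem abs_integral_wave_mul_le {a d : ℝ} (ha : 0 ≤ a) (hd : 0 ≤ d) (had : a + 2 * d ≤ 1)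
    {f : unitInterval → ℝ} (hf : ∀ s, |f s| ≤ 1) :
    |∫ s : unitInterval, wave a d s * f s| ≤ 2 * d := by
  rw [← Real.norm_eq_abs]
  calc ‖∫ s : unitInterval, wave a d s * f s‖
      ≤ ∫ s : unitInterval, (Set.Ioc a (a + 2 * d)).indicator (fun _ => 1) (s : ℝ) := by
        refine norm_integral_le_of_norm_le (integrable_indicator_Ioc continuous_const _ _)
          (.of_forall fun s => ?_)
        by_cases hs : (s : ℝ) ∈ Set.Ioc a (a + 2 * d)
        · rw [Set.indicator_of_mem hs, norm_mul]
          exact mul_le_one₀ (abs_wave_le _ _ _) (norm_nonneg _) (hf s)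
        · rw [wave_of_notMem hd hs, Set.indicator_of_notMem hs]
          simp
    _ = 2 * d := by
        rw [integral_indicator_Ioc ha (by linarith) had]
        simp

/-! ### Laws with a density -/

/-- The measure on `[0,1]²` with density `f`. -/
noncomputable def lawOf (f : Valuations → ℝ) : Measure Valuations :=
  volume.withDensity fun v => ENNReal.ofReal (f v)

theorem isSmooth_lawOf {f : Valuations → ℝ} {σ : ℝ} (hσ₀ : 0 < σ) (hσ : σ ≤ 1 / 9)
    (hf₉ : ∀ v, f v ≤ 9) :
    IsSmooth σ (lawOf f) := by
  intro S hS
  rw [lawOf, withDensity_apply _ hS]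
  calc ∫⁻ v in S, ENNReal.ofReal (f v) ≤ ∫⁻ _ in S, ENNReal.ofReal (σ⁻¹) := by
        refine lintegral_mono fun v => ENNReal.ofReal_le_ofReal ((hf₉ v).trans ?_)
        rw [le_inv_comm₀ (by norm_num) hσ₀]
        linarith
    _ = volume S / ENNReal.ofReal σ := by
        rw [setLIntegral_const, ENNReal.ofReal_inv_of_pos hσ₀, mul_comm, div_eq_mul_inv]

theorem integral_lawOf {f : Valuations → ℝ} (hf : Measurable f) (hf₀ : ∀ v, 0 ≤ f v)
    (g : Valuations → ℝ) : ∫ v, g v ∂(lawOf f) = ∫ v, f v * g v := by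
  rw [lawOf, integral_withDensity_eq_integral_toReal_smul hf.ennreal_ofReal
    (.of_forall fun v => ENNReal.ofReal_lt_top)]
  refine integral_congr_ae (.of_forall fun v => ?_)
  simp only [ENNReal.toReal_ofReal (hf₀ v), smul_eq_mul]

theorem isProbabilityMeasure_lawOf {f : Valuations → ℝ} (hf₀ : ∀ v, 0 ≤ f v)
    (hf₁ : ∫ v, f v = 1) : IsProbabilityMeasure (lawOf f) := by
  refine ⟨?_⟩
  have hi : Integrable f := by
    by_contra h
    rw [integral_undef h] at hf₁
    exact zero_ne_one hf₁
  rw [lawOf, withDensity_apply _ .univ, setLIntegral_univ,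
    ← ofReal_integral_eq_lintegral_ofReal hi (.of_forall hf₀), hf₁, ENNReal.ofReal_one]

theorem measureReal_le_lawOf {f : Valuations → ℝ} (hf : Measurable f) {S U : Set Valuations}
    (hS : MeasurableSet S) (hSU : S ⊆ U) [IsFiniteMeasure (lawOf f)] (h : ∀ v ∈ S, 1 ≤ f v) : volume.real S ≤ (lawOf f).real U := by
  refine le_trans ?_ (measureReal_mono hSU)
  refine ENNReal.toReal_mono (measure_ne_top _ _) ?_
  rw [lawOf, withDensity_apply _ hS, ← setLIntegral_one]
  refine setLIntegral_mono hf.ennreal_ofReal fun v hv => ?_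
  rw [← ENNReal.ofReal_one]
  exact ENNReal.ofReal_le_ofReal (h v hv)

/-- The rectangle `[u, u'] × [w, w']`. -/
def box (u u' w w' : ℝ) : Set Valuations :=
  {v | (v.1 : ℝ) ∈ Set.Icc u u' ∧ (v.2 : ℝ) ∈ Set.Icc w w'}

theorem measurableSet_box (u u' w w' : ℝ) : MeasurableSet (box u u' w w') :=
  (measurable_fst.subtype_val measurableSet_Icc).inter
    (measurable_snd.subtype_val measurableSet_Icc)

theorem volumeReal_box {u u' w w' : ℝ} (hu : 0 ≤ u) (huu : u ≤ u') (hu' : u' ≤ 1) (hw : 0 ≤ w)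
    (hww : w ≤ w') (hw' : w' ≤ 1) : volume.real (box u u' w w') = (u' - u) * (w' - w) := by
  have e : box u u' w w' =
      Set.Icc (⟨u, hu, huu.trans hu'⟩ : unitInterval) ⟨u', hu.trans huu, hu'⟩ ×ˢ
        Set.Icc (⟨w, hw, hww.trans hw'⟩ : unitInterval) ⟨w', hw.trans hww, hw'⟩ := rfl
  rw [e, Measure.volume_eq_prod, measureReal_prod_prod]
  simp only [Measure.real, unitInterval.volume_Icc]
  rw [ENNReal.toReal_ofReal (by linarith), ENNReal.toReal_ofReal (by linarith)]

/-! ### The base density -/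

/-- The band `{(s, b) | s ≤ b ≤ s + 3/8}`. -/
def band : Set Valuations := {v | (v.1 : ℝ) ≤ v.2 ∧ (v.2 : ℝ) - v.1 ≤ 3 / 8}

/-- The corners `(0, 1)` and `(1, 0)` of the square. -/
def corner : Set Valuations := box 0 (1 / 4) (3 / 4) 1 ∪ box (3 / 4) 1 0 (1 / 4)

theorem measurableSet_band : MeasurableSet band :=
  (measurableSet_le measurable_fst.subtype_val measurable_snd.subtype_val).inter
    (measurableSet_le (measurable_snd.subtype_val.sub measurable_fst.subtype_val)
      measurable_const)

theorem measurableSet_corner : MeasurableSet corner :=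
  (measurableSet_box _ _ _ _).union (measurableSet_box _ _ _ _)

theorem notMem_corner_of_mem_band {v : Valuations} (hv : v ∈ band) : v ∉ corner := by
  rintro (h | h)
  · linarith [hv.2, h.1.2, h.2.1]
  · linarith [hv.1, h.1.1, h.2.2]

theorem volumeReal_corner : volume.real corner = 1 / 8 := by
  rw [corner, measureReal_union ?_ (measurableSet_box _ _ _ _), volumeReal_box, volumeReal_box]
  any_goals norm_num
  refine Set.disjoint_left.2 fun v h1 h2 => ?_
  linarith [h1.1.2, h2.1.1]

/-- The density on the corners, which makes `baseDensity` a probability density. -/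
noncomputable def cornerDensity : ℝ := 8 * (1 - volume.real band)

theorem cornerDensity_le : cornerDensity ≤ 8 := by
  have : 0 ≤ volume.real band := measureReal_nonneg
  unfold cornerDensity
  linarith

/-- The band misses a square of side `3/8`, whose area `9/64` exceeds the corner area `1/8`. -/
theorem one_le_cornerDensity : 1 ≤ cornerDensity := by
  have h1 : band ⊆ (box (5 / 8) 1 0 (3 / 8))ᶜ := fun v hv h => by linarith [hv.1, h.1.1, h.2.2]
  have h2 := measureReal_mono (μ := volume) h1
  rw [probReal_compl_eq_one_sub (measurableSet_box _ _ _ _), volumeReal_box] at h2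
  any_goals norm_num
  unfold cornerDensity
  linarith

/-- A density for which the gain from trade of a single price `p` is constant and maximal for
`p ∈ [3/8, 5/8]`. -/
noncomputable def baseDensity (v : Valuations) : ℝ :=
  band.indicator 1 v + cornerDensity * corner.indicator 1 v

theorem measurable_baseDensity : Measurable baseDensity :=
  (measurable_one.indicator measurableSet_band).add
    ((measurable_one.indicator measurableSet_corner).const_mul _)

theorem baseDensity_of_mem_band {v : Valuations} (hv : v ∈ band) : baseDensity v = 1 := by
  simp [baseDensity, hv, notMem_corner_of_mem_band hv]

theorem baseDensity_nonneg (v : Valuations) : 0 ≤ baseDensity v :=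
  add_nonneg (Set.indicator_nonneg (fun _ _ => zero_le_one) _)
    (mul_nonneg (by linarith [one_le_cornerDensity])
      (Set.indicator_nonneg (fun _ _ => zero_le_one) _))

theorem baseDensity_le (v : Valuations) : baseDensity v ≤ 8 := by
  by_cases hv : v ∈ band
  · rw [baseDensity_of_mem_band hv]; norm_num
  · rw [baseDensity, Set.indicator_of_notMem hv, zero_add]
    by_cases hc : v ∈ corner
    · simpa [hc] using cornerDensity_le
    · simp [hc]

theorem one_le_baseDensity_of_mem_corner {v : Valuations} (hv : v ∈ corner) :
    1 ≤ baseDensity v := by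
  have : v ∉ band := fun h => notMem_corner_of_mem_band h hv
  simpa [baseDensity, hv, this] using one_le_cornerDensity

theorem integrable_indicator_one {S : Set Valuations} (hS : MeasurableSet S) :
    Integrable (S.indicator (1 : Valuations → ℝ)) :=
  (integrable_const (1 : ℝ)).indicator hS

theorem integral_baseDensity : ∫ v, baseDensity v = 1 := by
  unfold baseDensity
  rw [integral_add (integrable_indicator_one measurableSet_band)
    ((integrable_indicator_one measurableSet_corner).const_mul _), integral_const_mul,
    integral_indicator_one measurableSet_band, integral_indicator_one measurableSet_corner,
    volumeReal_corner, cornerDensity]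
  ring

/-! ### Optimal single prices for the base density -/

/-- The single price `p`, posted to both sides. -/
def diag (p : unitInterval) : Prices := ⟨(p, p), le_rfl⟩

theorem GFT_diag (p : unitInterval) (v : Valuations) :
    GFT (diag p) v = if v.1 ≤ p ∧ p ≤ v.2 then (v.2 : ℝ) - v.1 else 0 := by
  simp only [GFT, diag, le_refl, true_and]
  split_ifs <;> ring

/-- Offering the seller's price to the buyer as well can only enable more trades, and leaves no
spread unclaimed. -/
theorem GFT_le_GFT_diag (x : Prices) (v : Valuations) : GFT x v ≤ GFT (diag x.1.1) v := by
  have hx : (x.1.1 : ℝ) ≤ x.1.2 := x.2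
  rw [GFT_diag]
  by_cases h : v.1 ≤ x.1.1 ∧ x.1.1 ≤ x.1.2 ∧ x.1.2 ≤ v.2
  · rw [GFT, if_pos h, if_pos ⟨h.1, h.2.1.trans h.2.2⟩]
    linarith
  · rw [GFT, if_neg h]
    split_ifs with h'
    · have : (v.1 : ℝ) ≤ v.2 := h'.1.trans h'.2
      linarith
    · exact le_rfl

theorem measurable_GFT_right (x : Prices) : Measurable (GFT x) :=
  measurable_GFT.comp measurable_prodMk_left

theorem integrable_mul_of_bound {f g : Valuations → ℝ} (hf : Measurable f) (hg : Measurable g)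
    {C C' : ℝ} (hfC : ∀ v, |f v| ≤ C) (hgC : ∀ v, |g v| ≤ C') :
    Integrable fun v => f v * g v :=
  .of_bound (hf.mul hg).aestronglyMeasurable (C * C') (.of_forall fun v => by
    rw [norm_mul]
    exact mul_le_mul (hfC v) (hgC v) (norm_nonneg _) ((abs_nonneg _).trans (hfC v)))

theorem abs_GFT_le (x : Prices) (v : Valuations) : |GFT x v| ≤ 1 := by
  rw [abs_of_nonneg (GFT_nonneg x v)]
  exact GFT_le_one x v

theorem abs_baseDensity_le (v : Valuations) : |baseDensity v| ≤ 8 := by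
  rw [abs_of_nonneg (baseDensity_nonneg v)]
  exact baseDensity_le v

theorem abs_indicator_one_le {α : Type*} (S : Set α) (v : α) : |S.indicator (1 : α → ℝ) v| ≤ 1 := by
  by_cases h : v ∈ S <;> simp [h]

open Classical in
/-- The gain from trade of the single price `p` on the band, as a function on the plane. -/
noncomputable def planeGain (p : ℝ) (y : ℝ × ℝ) : ℝ≥0∞ :=
  if y.1 ≤ p ∧ p ≤ y.2 ∧ y.2 - y.1 ≤ 3 / 8 then ENNReal.ofReal (y.2 - y.1) else 0

theorem measurable_planeGain (p : ℝ) : Measurable (planeGain p) := by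
  refine Measurable.ite ?_ (by fun_prop) measurable_const
  exact (measurableSet_le measurable_fst measurable_const).inter
    ((measurableSet_le measurable_const measurable_snd).inter
      (measurableSet_le (measurable_snd.sub measurable_fst) measurable_const))

/-- Translation by `(q - p, q - p)` preserves `b - s` and carries one trading region onto the other.
-/
theorem lintegral_planeGain (p q : ℝ) : ∫⁻ y, planeGain p y = ∫⁻ y, planeGain q y := by
  rw [← lintegral_add_right_eq_self (planeGain q) ((q - p, q - p) : ℝ × ℝ)]
  refine lintegral_congr fun y => ?_
  simp only [planeGain, Prod.fst_add, Prod.snd_add]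
  have e1 : y.2 + (q - p) - (y.1 + (q - p)) = y.2 - y.1 := by ring
  have e2 : y.1 + (q - p) ≤ q ↔ y.1 ≤ p := by constructor <;> intro h <;> linarith
  have e3 : q ≤ y.2 + (q - p) ↔ p ≤ y.2 := by constructor <;> intro h <;> linarith
  simp only [e1, e2, e3]

theorem lintegral_valuations {F : ℝ × ℝ → ℝ≥0∞} (hF : Measurable F) :
    ∫⁻ v : Valuations, F (v.1, v.2) = ∫⁻ y in Set.Icc 0 1 ×ˢ Set.Icc 0 1, F y := by
  have h := unitInterval.measurePreserving_coe.prod unitInterval.measurePreserving_coe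
  rw [Measure.prod_restrict] at h
  exact h.lintegral_comp hF

theorem integral_band_GFT_diag_eq (p : unitInterval) :
    ∫ v, band.indicator 1 v * GFT (diag p) v =
      (∫⁻ y in Set.Icc 0 1 ×ˢ Set.Icc 0 1, planeGain p y).toReal := by
  rw [← lintegral_valuations (measurable_planeGain p), integral_eq_lintegral_of_nonneg_ae
    (f := fun v => band.indicator 1 v * GFT (diag p) v)
    (.of_forall fun v => mul_nonneg (Set.indicator_nonneg (fun _ _ => zero_le_one) _)
      (GFT_nonneg _ _))
    ((measurable_one.indicator measurableSet_band).mul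
      (measurable_GFT_right _)).aestronglyMeasurable]
  congr 1
  refine lintegral_congr fun v => ?_
  rw [GFT_diag, planeGain]
  by_cases h1 : v.1 ≤ p ∧ p ≤ v.2
  · have h2 : (v.1 : ℝ) ≤ p := h1.1
    have h3 : (p : ℝ) ≤ v.2 := h1.2
    by_cases h4 : (v.2 : ℝ) - v.1 ≤ 3 / 8
    · have : v ∈ band := ⟨h2.trans h3, h4⟩
      simp [this, h1, h2, h3, h4]
    · have : v ∉ band := fun h => h4 h.2
      simp only [this, h4, not_false_eq_true, Set.indicator_of_notMem, zero_mul,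
        ENNReal.ofReal_zero, and_false, if_false]
  · have : ¬ ((v.1 : ℝ) ≤ p ∧ (p : ℝ) ≤ v.2 ∧ (v.2 : ℝ) - v.1 ≤ 3 / 8) := fun h => h1 ⟨h.1, h.2.1⟩
    rw [if_neg h1, if_neg this, mul_zero, ENNReal.ofReal_zero]

/-- Restricting to the square can only lower the planar integral, which does not depend on the
price. For `q` it loses nothing: `s ≤ q ≤ b ≤ s + 3/8` forces `s ≥ q - 3/8 ≥ 0` and `b ≤ q + 3/8 ≤
1`. -/
theorem integral_band_GFT_diag_le (p q : unitInterval) (hq : (q : ℝ) ∈ Set.Icc (3 / 8) (5 / 8)) :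
    ∫ v, band.indicator 1 v * GFT (diag p) v ≤ ∫ v, band.indicator 1 v * GFT (diag q) v := by
  rw [integral_band_GFT_diag_eq, integral_band_GFT_diag_eq]
  refine ENNReal.toReal_mono (ne_of_lt ?_) ?_
  · rw [← lintegral_valuations (measurable_planeGain q)]
    refine lt_of_le_of_lt (b := ∫⁻ v : Valuations, 1) (lintegral_mono fun v => ?_) (by simp)
    unfold planeGain
    split_ifs
    · rw [ENNReal.ofReal_le_one]
      linarith [v.2.2.2, v.1.2.1]
    · exact zero_le_one
  · calc ∫⁻ y in Set.Icc 0 1 ×ˢ Set.Icc 0 1, planeGain p y ≤ ∫⁻ y, planeGain p y :=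
          setLIntegral_le_lintegral _ _
      _ = ∫⁻ y, planeGain q y := lintegral_planeGain _ _
      _ = ∫⁻ y in Set.Icc 0 1 ×ˢ Set.Icc 0 1, planeGain q y := by
          rw [← lintegral_indicator (measurableSet_Icc.prod measurableSet_Icc)]
          refine lintegral_congr fun y => ?_
          by_cases hy : y ∈ (Set.Icc 0 1 ×ˢ Set.Icc 0 1 : Set (ℝ × ℝ))
          · rw [Set.indicator_of_mem hy]
          · rw [Set.indicator_of_notMem hy, planeGain, if_neg]
            rintro ⟨h1, h2, h3⟩
            exact hy ⟨⟨by linarith [hq.1], by linarith [hq.2]⟩,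
              ⟨by linarith [hq.1], by linarith [hq.2]⟩⟩

theorem integral_baseDensity_GFT_diag_le (p q : unitInterval)
    (hq : (q : ℝ) ∈ Set.Icc (3 / 8) (5 / 8)) :
    ∫ v, baseDensity v * GFT (diag p) v ≤ ∫ v, baseDensity v * GFT (diag q) v := by
  have hb : ∀ r, Integrable fun v => band.indicator (1 : Valuations → ℝ) v * GFT (diag r) v := fun r =>
    integrable_mul_of_bound (measurable_one.indicator measurableSet_band) (measurable_GFT_right _)
      (abs_indicator_one_le _) (abs_GFT_le _)
  have hc : ∀ r, Integrable fun v => corner.indicator 1 v * GFT (diag r) v := fun r =>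
    integrable_mul_of_bound (measurable_one.indicator measurableSet_corner)
      (measurable_GFT_right _) (abs_indicator_one_le _) (abs_GFT_le _)
  have e : ∀ r, ∫ v, baseDensity v * GFT (diag r) v =
      (∫ v, band.indicator 1 v * GFT (diag r) v) +
        cornerDensity * ∫ v, corner.indicator 1 v * GFT (diag r) v := fun r => by
    rw [← integral_const_mul, ← integral_add (hb r) ((hc r).const_mul _)]
    simp only [baseDensity, add_mul, mul_assoc]
  rw [e, e]
  refine add_le_add (integral_band_GFT_diag_le p q hq)
    (mul_le_mul_of_nonneg_left (integral_mono (hc p) (hc q) fun v => ?_)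
      (by linarith [one_le_cornerDensity]))
  by_cases hv : v ∈ corner
  · simp only [hv, Set.indicator_of_mem, Pi.one_apply, one_mul]
    -- In the corner `(0, 1)` the price `q` always trades, which is the best possible; in the corner
    -- `(1, 0)` no price trades.
    rcases hv with hv | hv
    · have h1 : v.1 ≤ q := Subtype.coe_le_coe.1 (by linarith [hv.1.2, hq.1])
      have h2 : q ≤ v.2 := Subtype.coe_le_coe.1 (by linarith [hv.2.1, hq.2])
      rw [GFT_diag p, GFT_diag q, if_pos (show v.1 ≤ q ∧ q ≤ v.2 from ⟨h1, h2⟩)]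
      split_ifs
      · exact le_rfl
      · linarith [hv.1.2, hv.2.1]
    · have : ¬ (v.1 ≤ p ∧ p ≤ v.2) := fun h => by
        have : (v.1 : ℝ) ≤ v.2 := h.1.trans h.2
        linarith [hv.1.1, hv.2.2]
      rw [GFT_diag, if_neg this]
      exact GFT_nonneg _ _
  · simp [hv]

/-! ### The perturbation and its effect on feedback and gain -/

/-- A perturbation of `baseDensity`, supported in `(a, a + 2 d] × (5/8, 3/4]`. -/
noncomputable def perturbation (a d : ℝ) (v : Valuations) : ℝ :=
  -(wave a d v.1 * wave (5 / 8) (1 / 16) v.2)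

theorem measurable_perturbation (a d : ℝ) : Measurable (perturbation a d) :=
  (((measurable_wave a d).comp measurable_fst.subtype_val).mul
    ((measurable_wave _ _).comp measurable_snd.subtype_val)).neg

theorem abs_perturbation_le (a d : ℝ) (v : Valuations) : |perturbation a d v| ≤ 1 := by
  rw [perturbation, abs_neg, abs_mul]
  exact mul_le_one₀ (abs_wave_le _ _ _) (abs_nonneg _) (abs_wave_le _ _ _)

theorem integral_perturbation_mul (a d : ℝ) (f g : unitInterval → ℝ) :
    ∫ v, perturbation a d v * (f v.1 * g v.2) =
      -((∫ s : unitInterval, wave a d s * f s) *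
        ∫ b : unitInterval, wave (5 / 8) (1 / 16) b * g b) := by
  rw [← integral_prod_mul, ← integral_neg, ← Measure.volume_eq_prod]
  refine integral_congr_ae (.of_forall fun v => ?_)
  simp only [perturbation]
  ring

/-- The perturbed density. -/
noncomputable def perturbedDensity (a d : ℝ) (v : Valuations) : ℝ :=
  baseDensity v + perturbation a d v

theorem measurable_perturbedDensity (a d : ℝ) : Measurable (perturbedDensity a d) :=
  measurable_baseDensity.add (measurable_perturbation a d)

theorem perturbedDensity_le (a d : ℝ) (v : Valuations) : perturbedDensity a d v ≤ 9 := by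
  unfold perturbedDensity
  linarith [baseDensity_le v, (abs_le.1 (abs_perturbation_le a d v)).2]

/-- The support of the perturbation lies inside the band, where the base density is one and the
perturbation at least minus one. -/
theorem perturbedDensity_nonneg {a d : ℝ} (ha : 3 / 8 ≤ a) (hd : 0 ≤ d) (had : a + 2 * d ≤ 1 / 2)
    (v : Valuations) : 0 ≤ perturbedDensity a d v := by
  unfold perturbedDensity
  by_cases h1 : (v.1 : ℝ) ∈ Set.Ioc a (a + 2 * d)
  · by_cases h2 : (v.2 : ℝ) ∈ Set.Ioc (5 / 8 : ℝ) (5 / 8 + 2 * (1 / 16))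
    · rw [baseDensity_of_mem_band ⟨by linarith [h1.2, h2.1], by linarith [h1.1, h2.2]⟩]
      linarith [(abs_le.1 (abs_perturbation_le a d v)).1]
    · rw [perturbation, wave_of_notMem (by norm_num) h2, mul_zero, neg_zero, add_zero]
      exact baseDensity_nonneg v
  · rw [perturbation, wave_of_notMem hd h1, zero_mul, neg_zero, add_zero]
    exact baseDensity_nonneg v

theorem integral_perturbedDensity_mul (a d : ℝ) {g : Valuations → ℝ} (hg : Measurable g)
    (hg₁ : ∀ v, |g v| ≤ 1) :
    ∫ v, perturbedDensity a d v * g v =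
      (∫ v, baseDensity v * g v) + ∫ v, perturbation a d v * g v := by
  rw [← integral_add (integrable_mul_of_bound measurable_baseDensity hg abs_baseDensity_le hg₁)
    (integrable_mul_of_bound (measurable_perturbation a d) hg (abs_perturbation_le a d) hg₁)]
  simp only [perturbedDensity, add_mul]

theorem integral_perturbedDensity {a d : ℝ} (ha : 3 / 8 ≤ a) (hd : 0 ≤ d)
    (had : a + 2 * d ≤ 1 / 2) : ∫ v, perturbedDensity a d v = 1 := by
  have h1 := integral_perturbedDensity_mul a d (g := fun _ => 1) measurable_const (by simp)
  have h2 := integral_perturbation_mul a d (fun _ => 1) (fun _ => 1)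
  rw [integral_wave_mul_const (by linarith) hd (by linarith) (c := 1) (fun _ _ => rfl)] at h2
  simp only [mul_one, integral_baseDensity] at h1 h2
  rw [h1, h2]
  simp

open Classical in
theorem indicator_twoBit (x : Prices) (z : Bool × Bool) (v : Valuations) :
    {v | twoBit x v = z}.indicator (1 : Valuations → ℝ) v =
      (if decide (v.1 ≤ x.1.1) = z.1 then 1 else 0) *
        (if decide (x.1.2 ≤ v.2) = z.2 then 1 else 0) := by
  simp only [Set.indicator, twoBit, Set.mem_ofPred_eq, Prod.ext_iff, Pi.one_apply]
  split_ifs <;> simp_all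

/-- The prices whose feedback distinguishes the perturbed density from `baseDensity`. -/
def informative (a d : ℝ) : Set Prices :=
  {x | (x.1.1 : ℝ) ∈ Set.Ioc a (a + 2 * d) ∧
    (x.1.2 : ℝ) ∈ Set.Ioc (5 / 8 : ℝ) (5 / 8 + 2 * (1 / 16))}

/-- The prices that may be optimal for the perturbed density. -/
def competitive (a d : ℝ) : Set Prices := {x | (x.1.1 : ℝ) ∈ Set.Ioc a (a + 2 * d)}

theorem measurableSet_competitive (a d : ℝ) : MeasurableSet (competitive a d) :=
  measurable_subtype_coe.fst.subtype_val measurableSet_Ioc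

theorem measurableSet_informative (a d : ℝ) : MeasurableSet (informative a d) :=
  (measurableSet_competitive a d).inter (measurable_subtype_coe.snd.subtype_val measurableSet_Ioc)

open Classical in
-- The integral factors into an `s`-part and a `b`-part. If `p` or `q` lies outside its window, the
-- corresponding bit is constant on the support of its wave, and the wave has mean zero.
theorem integral_perturbation_twoBit_of_notMem {a d : ℝ} (ha : 0 ≤ a) (hd : 0 ≤ d)
    (had : a + 2 * d ≤ 1) {x : Prices} (hx : x ∉ informative a d) (z : Bool × Bool) :
    ∫ v, perturbation a d v * {v | twoBit x v = z}.indicator 1 v = 0 := by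
  simp only [indicator_twoBit]
  rw [integral_perturbation_mul a d (fun s => if decide (s ≤ x.1.1) = z.1 then 1 else 0)
    (fun b => if decide (x.1.2 ≤ b) = z.2 then 1 else 0)]
  have hx' : x.1.1.1 ∉ Set.Ioc a (a + 2 * d) ∨
      x.1.2.1 ∉ Set.Ioc (5 / 8 : ℝ) (5 / 8 + 2 * (1 / 16)) := by
    by_contra h
    push Not at h
    exact hx h
  rcases hx' with h | h
  · rw [integral_wave_mul_const ha hd had
      (c := if decide (x.1.1.1 > a + 2 * d) = z.1 then 1 else 0), zero_mul, neg_zero]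
    intro s hs
    congr 3
    rw [eq_iff_iff, ← Subtype.coe_le_coe]
    rw [Set.mem_Ioc, not_and_or, not_lt, not_le] at h
    constructor
    · intro h'
      rcases h with h | h
      · linarith [hs.1]
      · exact h
    · intro h'
      linarith [hs.2]
  · rw [integral_wave_mul_const (a := 5 / 8) (d := 1 / 16) (by norm_num) (by norm_num) (by norm_num)
      (c := if decide (x.1.2.1 ≤ 5 / 8) = z.2 then 1 else 0), mul_zero, neg_zero]
    intro s hs
    congr 3
    rw [eq_iff_iff, ← Subtype.coe_le_coe]
    rw [Set.mem_Ioc, not_and_or, not_lt, not_le] at h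
    constructor
    · intro h'
      rcases h with h | h
      · exact h
      · linarith [hs.2]
    · intro h'
      linarith [hs.1]

theorem abs_integral_perturbation_twoBit_le {a d : ℝ} (ha : 0 ≤ a) (hd : 0 ≤ d)
    (had : a + 2 * d ≤ 1) (x : Prices) (z : Bool × Bool) :
    |∫ v, perturbation a d v * {v | twoBit x v = z}.indicator 1 v| ≤ d / 4 := by
  classical
  simp only [indicator_twoBit]
  rw [integral_perturbation_mul a d (fun s => if decide (s ≤ x.1.1) = z.1 then 1 else 0)
    (fun b => if decide (x.1.2 ≤ b) = z.2 then 1 else 0), abs_neg, abs_mul]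
  have h1 := abs_integral_wave_mul_le ha hd had
    (f := fun s => if decide (s ≤ x.1.1) = z.1 then 1 else 0) (fun s => by split_ifs <;> simp)
  have h2 := abs_integral_wave_mul_le (a := 5 / 8) (d := 1 / 16) (by norm_num) (by norm_num)
    (by norm_num)
    (f := fun b => if decide (x.1.2 ≤ b) = z.2 then 1 else 0) (fun s => by split_ifs <;> simp)
  refine (mul_le_mul h1 h2 (abs_nonneg _) (by linarith)).trans (le_of_eq (by ring))

theorem integral_perturbation_GFT_diag (a d : ℝ) (p : unitInterval) :
    ∫ v, perturbation a d v * GFT (diag p) v =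
      (∫ s : unitInterval, wave a d s * (if s ≤ p then (s : ℝ) else 0)) *
        (∫ b : unitInterval, wave (5 / 8) (1 / 16) b * (if p ≤ b then 1 else 0)) -
      (∫ s : unitInterval, wave a d s * (if s ≤ p then 1 else 0)) *
        ∫ b : unitInterval, wave (5 / 8) (1 / 16) b * (if p ≤ b then (b : ℝ) else 0) := by
  have e : ∀ v : Valuations, perturbation a d v * GFT (diag p) v =
      perturbation a d v * ((if v.1 ≤ p then 1 else 0) * (if p ≤ v.2 then (v.2 : ℝ) else 0)) -
      perturbation a d v * ((if v.1 ≤ p then (v.1 : ℝ) else 0) * (if p ≤ v.2 then 1 else 0)) :=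
    fun v => by
      rw [GFT_diag]
      by_cases h1 : v.1 ≤ p <;> by_cases h2 : p ≤ v.2 <;> simp [h1, h2]
      ring
  have hI : ∀ r : unitInterval, |(r : ℝ)| ≤ 1 := fun r => by
    rw [abs_of_nonneg r.2.1]; exact r.2.2
  have m1 : MeasurableSet {v : Valuations | v.1 ≤ p} := measurableSet_le measurable_fst measurable_const
  have m2 : MeasurableSet {v : Valuations | p ≤ v.2} := measurableSet_le measurable_const measurable_snd
  simp only [e]
  rw [integral_sub, integral_perturbation_mul a d (fun s => if s ≤ p then 1 else 0)
      (fun b => if p ≤ b then (b : ℝ) else 0),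
    integral_perturbation_mul a d (fun s => if s ≤ p then (s : ℝ) else 0)
      (fun b => if p ≤ b then 1 else 0)]
  · ring
  · refine integrable_mul_of_bound (C' := 1) (measurable_perturbation a d) ?_
      (abs_perturbation_le a d) fun v => ?_
    · exact (Measurable.ite m1 measurable_const measurable_const).mul
        (Measurable.ite m2 measurable_snd.subtype_val measurable_const)
    · rw [abs_mul]
      refine mul_le_one₀ ?_ (abs_nonneg _) ?_ <;> split_ifs <;> simp [hI]
  · refine integrable_mul_of_bound (C' := 1) (measurable_perturbation a d) ?_
      (abs_perturbation_le a d) fun v => ?_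
    · exact (Measurable.ite m1 measurable_fst.subtype_val measurable_const).mul
        (Measurable.ite m2 measurable_const measurable_const)
    · rw [abs_mul]
      refine mul_le_one₀ ?_ (abs_nonneg _) ?_ <;> split_ifs <;> simp [hI]

/-- All `b` in the support accept `p`, so the `b`-wave contributes its mean `0` and its first moment
`-(1/16)² = -1/256`. What remains, as a function of `p`, is a tent over the strip. -/
theorem integral_perturbation_GFT_diag_of_le (a d : ℝ) {p : unitInterval} (hp : (p : ℝ) ≤ 5 / 8) :
    ∫ v, perturbation a d v * GFT (diag p) v =
      (∫ s : unitInterval, wave a d s * (if s ≤ p then 1 else 0)) / 256 := by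
  have h : ∀ b : unitInterval, (b : ℝ) ∈ Set.Ioc (5 / 8 : ℝ) (5 / 8 + 2 * (1 / 16)) → p ≤ b :=
    fun b hb => Subtype.coe_le_coe.1 (by linarith [hb.1])
  rw [integral_perturbation_GFT_diag, integral_wave_mul_const (a := 5 / 8) (d := 1 / 16)
      (by norm_num) (by norm_num) (by norm_num) (c := 1) (fun b hb => if_pos (h b hb)),
    integral_wave_mul_linear (a := 5 / 8) (d := 1 / 16)
      (by norm_num) (by norm_num) (by norm_num) (c := 1)
      (fun b hb => by rw [if_pos (h b hb), one_mul])]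
  ring

theorem integral_perturbation_GFT_diag_midpoint {a d : ℝ} (ha : 0 ≤ a) (hd : 0 ≤ d)
    (had : a + 2 * d ≤ 5 / 8) {p : unitInterval} (hp : (p : ℝ) = a + d) :
    ∫ v, perturbation a d v * GFT (diag p) v = d / 256 := by
  rw [integral_perturbation_GFT_diag_of_le a d (by linarith)]
  congr 1
  -- Cutting at the midpoint keeps exactly the positive half of the wave, the peak of the tent.
  have e : ∀ s : unitInterval, wave a d s * (if s ≤ p then 1 else 0) =
      (Set.Ioc a (a + d)).indicator (fun _ => 1) (s : ℝ) := fun s => by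
    simp only [wave, Set.indicator, Set.mem_Ioc, ← Subtype.coe_le_coe, hp, Pi.one_apply]
    by_cases h : (s : ℝ) ≤ a + d
    · have : ¬ a + d < s := not_lt.2 h
      simp [h, this]
    · simp [h]
  simp only [e]
  rw [integral_indicator_Ioc ha (by linarith) (by linarith)]
  simp

theorem integral_perturbation_GFT_diag_le {a d : ℝ} (ha : 0 ≤ a) (hd : 0 ≤ d)
    (had : a + 2 * d ≤ 5 / 8) {p : unitInterval} (hp : (p : ℝ) ∈ Set.Ioc a (a + 2 * d)) :
    ∫ v, perturbation a d v * GFT (diag p) v ≤ d / 256 := by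
  rw [integral_perturbation_GFT_diag_of_le a d (hp.2.trans had)]
  refine div_le_div_of_nonneg_right (integral_wave_mul_le ha hd (by linarith) ?_ ?_ ?_)
    (by norm_num)
  · exact Measurable.ite (measurableSet_le measurable_id measurable_const) measurable_const
      measurable_const
  · intro s; split_ifs <;> simp
  · intro s; split_ifs <;> simp

/-- Left of the strip no `s` in the support trades. Right of it all do, leaving the first moment
`-d²` times a `b`-integral of size at most `1/8`; this may be nonzero when `p` cuts the `b`-window.
-/
theorem integral_perturbation_GFT_diag_le_of_notMem {a d : ℝ} (ha : 0 ≤ a) (hd : 0 ≤ d)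
    (had : a + 2 * d ≤ 1) {p : unitInterval} (hp : (p : ℝ) ∉ Set.Ioc a (a + 2 * d)) :
    ∫ v, perturbation a d v * GFT (diag p) v ≤ d ^ 2 / 8 := by
  rw [integral_perturbation_GFT_diag]
  have hB := abs_integral_wave_mul_le (a := 5 / 8) (d := 1 / 16) (by norm_num) (by norm_num)
    (by norm_num) (f := fun b => if p ≤ b then 1 else 0) (fun s => by split_ifs <;> simp)
  set B := ∫ b : unitInterval, wave (5 / 8) (1 / 16) b * (if p ≤ b then 1 else 0)
  rw [Set.mem_Ioc, not_and_or, not_lt, not_le] at hp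
  rcases hp with hp | hp
  · have h : ∀ s : unitInterval, (s : ℝ) ∈ Set.Ioc a (a + 2 * d) → ¬ s ≤ p := fun s hs h => by
      have : (s : ℝ) ≤ p := h
      linarith [hs.1]
    rw [integral_wave_mul_const ha hd had (c := 0) (fun s hs => if_neg (h s hs)),
      integral_wave_mul_const ha hd had (c := 0) (fun s hs => if_neg (h s hs))]
    simp only [zero_mul, sub_zero]
    positivity
  · have h : ∀ s : unitInterval, (s : ℝ) ∈ Set.Ioc a (a + 2 * d) → s ≤ p := fun s hs =>
      Subtype.coe_le_coe.1 (by linarith [hs.2])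
    rw [integral_wave_mul_const ha hd had (c := 1) (fun s hs => if_pos (h s hs)),
      integral_wave_mul_linear ha hd had (c := 1)
        (fun s hs => by rw [if_pos (h s hs), one_mul])]
    nlinarith [(abs_le.1 hB).1, sq_nonneg d]

/-! ### Regret and feedback under the base and perturbed laws -/

theorem isProbabilityMeasure_base : IsProbabilityMeasure (lawOf baseDensity) :=
  isProbabilityMeasure_lawOf baseDensity_nonneg integral_baseDensity

theorem integral_sub_GFT (μ : Measure Valuations) [IsFiniteMeasure μ] (x y : Prices) :
    ∫ v, (GFT x v - GFT y v) ∂μ = (∫ v, GFT x v ∂μ) - ∫ v, GFT y v ∂μ := by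
  have h : ∀ x, Integrable (GFT x) μ := fun x =>
    .of_bound (measurable_GFT_right x).aestronglyMeasurable 1 (.of_forall (abs_GFT_le x))
  exact integral_sub (h x) (h y)

theorem integral_GFT_le_diag (μ : Measure Valuations) [IsFiniteMeasure μ] (x : Prices) :
    ∫ v, GFT x v ∂μ ≤ ∫ v, GFT (diag x.1.1) v ∂μ := by
  have h : ∀ x, Integrable (GFT x) μ := fun x =>
    .of_bound (measurable_GFT_right x).aestronglyMeasurable 1 (.of_forall (abs_GFT_le x))
  exact integral_mono (h _) (h _) (GFT_le_GFT_diag x)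

theorem integral_base_GFT_diag_le (p q : unitInterval) (hq : (q : ℝ) ∈ Set.Icc (3 / 8) (5 / 8)) :
    ∫ v, GFT (diag p) v ∂(lawOf baseDensity) ≤ ∫ v, GFT (diag q) v ∂(lawOf baseDensity) := by
  rw [integral_lawOf measurable_baseDensity baseDensity_nonneg,
    integral_lawOf measurable_baseDensity baseDensity_nonneg]
  exact integral_baseDensity_GFT_diag_le p q hq

theorem base_regret_nonneg {q : unitInterval} (hq : (q : ℝ) ∈ Set.Icc (3 / 8) (5 / 8))
    (x : Prices) : 0 ≤ ∫ v, (GFT (diag q) v - GFT x v) ∂(lawOf baseDensity) := by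
  have := isProbabilityMeasure_base
  rw [integral_sub_GFT]
  linarith [integral_GFT_le_diag (lawOf baseDensity) x, integral_base_GFT_diag_le x.1.1 q hq]

theorem base_regret_informative {q : unitInterval} (hq : (q : ℝ) ∈ Set.Icc (3 / 8) (5 / 8))
    {a d : ℝ} (ha : 3 / 8 ≤ a) (had : a + 2 * d ≤ 1 / 2) {x : Prices} (hx : x ∈ informative a d) :
    1 / 128 ≤ ∫ v, (GFT (diag q) v - GFT x v) ∂(lawOf baseDensity) := by
  have := isProbabilityMeasure_base
  have hp1 : (x.1.1 : ℝ) ∈ Set.Ioc a (a + 2 * d) := hx.1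
  have hp2 : (x.1.2 : ℝ) ∈ Set.Ioc (5 / 8 : ℝ) (5 / 8 + 2 * (1 / 16)) := hx.2
  have hS := measurableSet_box 0 (1 / 4) (3 / 4) 1
  have h1 : 1 / 16 ≤ (lawOf baseDensity).real (box 0 (1 / 4) (3 / 4) 1) := by
    refine le_trans (le_of_eq ?_) (measureReal_le_lawOf measurable_baseDensity hS subset_rfl
      fun v hv => one_le_baseDensity_of_mem_corner (Or.inl hv))
    rw [volumeReal_box] <;> norm_num
  have hm : ∀ x, Integrable (GFT x) (lawOf baseDensity) := fun x =>
    .of_bound (measurable_GFT_right x).aestronglyMeasurable 1 (.of_forall (abs_GFT_le x))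
  have hi : Integrable ((box 0 (1 / 4) (3 / 4) 1).indicator (1 : Valuations → ℝ))
      (lawOf baseDensity) := (integrable_const (1 : ℝ)).indicator hS
  -- On this corner both prices are accepted, but the spread `q - p ≥ 5/8 - 1/2 = 1/8` is forgone.
  have h2 : ∫ v, (1 / 8) * (box 0 (1 / 4) (3 / 4) 1).indicator 1 v ∂(lawOf baseDensity) ≤
      ∫ v, (GFT (diag x.1.1) v - GFT x v) ∂(lawOf baseDensity) := by
    refine integral_mono (hi.const_mul _) ((hm _).sub (hm _)) fun v => ?_
    by_cases hv : v ∈ box 0 (1 / 4) (3 / 4) 1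
    · have e1 : v.1 ≤ x.1.1 := Subtype.coe_le_coe.1 (by linarith [hv.1.2, hp1.1])
      have e2 : x.1.2 ≤ v.2 := Subtype.coe_le_coe.1 (by linarith [hv.2.1, hp2.2])
      have e3 : x.1.1 ≤ x.1.2 := x.2
      simp only [Set.indicator_of_mem hv, Pi.one_apply]
      rw [GFT_diag, if_pos ⟨e1, e3.trans e2⟩, GFT, if_pos ⟨e1, e3, e2⟩]
      linarith [hp1.2, hp2.1]
    · simp only [Set.indicator_of_notMem hv, mul_zero, sub_nonneg]
      exact GFT_le_GFT_diag x v
  rw [integral_const_mul, integral_indicator_one hS, integral_sub_GFT] at h2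
  rw [integral_sub_GFT]
  linarith [integral_base_GFT_diag_le x.1.1 q hq]

/-- For each value of the bits there is a box of area at least `1/32` that produces it and has
density at least one: a corner when the bits agree, a box in the band when they differ. The corner
`(1, 0)`, useless for trade, is there for the value `(false, false)`. -/
theorem base_twoBit_ge {a d : ℝ} (ha : 3 / 8 ≤ a) (had : a + 2 * d ≤ 1 / 2) {x : Prices}
    (hx : x ∈ informative a d) (z : Bool × Bool) :
    1 / 32 ≤ (lawOf baseDensity).real {v | twoBit x v = z} := by
  have := isProbabilityMeasure_base
  have hp : (x.1.1 : ℝ) ∈ Set.Ioc a (a + 2 * d) := hx.1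
  have hq : (x.1.2 : ℝ) ∈ Set.Ioc (5 / 8 : ℝ) (5 / 8 + 2 * (1 / 16)) := hx.2
  have key : ∀ {u u' w w' : ℝ}, 0 ≤ u → u ≤ u' → u' ≤ 1 → 0 ≤ w → w ≤ w' → w' ≤ 1 →
      1 / 32 ≤ (u' - u) * (w' - w) → box u u' w w' ⊆ {v | twoBit x v = z} →
      (∀ v ∈ box u u' w w', 1 ≤ baseDensity v) →
      1 / 32 ≤ (lawOf baseDensity).real {v | twoBit x v = z} := by
    intro u u' w w' h1 h2 h3 h4 h5 h6 h7 h8 h9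
    refine (h7.trans (le_of_eq (volumeReal_box h1 h2 h3 h4 h5 h6).symm)).trans ?_
    exact measureReal_le_lawOf measurable_baseDensity (measurableSet_box _ _ _ _) h8 h9
  have mem : ∀ v, v ∈ {v | twoBit x v = z} ↔
      ((v.1 : ℝ) ≤ x.1.1 ↔ z.1 = true) ∧ ((x.1.2 : ℝ) ≤ v.2 ↔ z.2 = true) := fun v => by
    rw [Set.mem_ofPred_eq, twoBit, Prod.ext_iff, Subtype.coe_le_coe, Subtype.coe_le_coe]
    refine and_congr ?_ ?_ <;> rw [Bool.eq_iff_iff] <;> simp only [decide_eq_true_iff]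
  rcases z with ⟨z₁ | z₁, z₂ | z₂⟩
  · refine key (u := 3 / 4) (u' := 1) (w := 0) (w' := 1 / 4) (by norm_num) (by norm_num)
      (by norm_num) (by norm_num) (by norm_num) (by norm_num) (by norm_num) (fun v hv => ?_)
      (fun v hv => one_le_baseDensity_of_mem_corner (Or.inr hv))
    rw [mem]
    simp only [Bool.false_eq_true, iff_false, not_le]
    exact ⟨by linarith [hv.1.1, hp.2], by linarith [hv.2.2, hq.1]⟩
  · refine key (u := 5 / 8) (u' := 3 / 4) (w := 3 / 4) (w' := 1) (by norm_num) (by norm_num)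
      (by norm_num) (by norm_num) (by norm_num) (by norm_num) (by norm_num) (fun v hv => ?_)
      (fun v hv => le_of_eq (baseDensity_of_mem_band
        ⟨by linarith [hv.1.2, hv.2.1], by linarith [hv.1.1, hv.2.2]⟩).symm)
    rw [mem]
    simp only [Bool.false_eq_true, iff_false, not_le, iff_true]
    exact ⟨by linarith [hv.1.1, hp.2], by linarith [hv.2.1, hq.2]⟩
  · refine key (u := 1 / 8) (u' := 3 / 8) (w := 3 / 8) (w' := 1 / 2) (by norm_num) (by norm_num)
      (by norm_num) (by norm_num) (by norm_num) (by norm_num) (by norm_num) (fun v hv => ?_)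
      (fun v hv => le_of_eq (baseDensity_of_mem_band
        ⟨by linarith [hv.1.2, hv.2.1], by linarith [hv.1.1, hv.2.2]⟩).symm)
    rw [mem]
    simp only [Bool.false_eq_true, iff_false, not_le, iff_true]
    exact ⟨by linarith [hv.1.2, hp.1], by linarith [hv.2.2, hq.1]⟩
  · refine key (u := 0) (u' := 1 / 4) (w := 3 / 4) (w' := 1) (by norm_num) (by norm_num)
      (by norm_num) (by norm_num) (by norm_num) (by norm_num) (by norm_num) (fun v hv => ?_)
      (fun v hv => one_le_baseDensity_of_mem_corner (Or.inl hv))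
    rw [mem]
    simp only [iff_true]
    exact ⟨by linarith [hv.1.2, hp.1], by linarith [hv.2.1, hq.2]⟩

theorem isProbabilityMeasure_perturbed {a d : ℝ} (ha : 3 / 8 ≤ a) (hd : 0 ≤ d) (had : a + 2 * d ≤ 1 / 2) :
    IsProbabilityMeasure (lawOf (perturbedDensity a d)) :=
  isProbabilityMeasure_lawOf (perturbedDensity_nonneg ha hd had)
    (integral_perturbedDensity ha hd had)

theorem integral_perturbed {a d : ℝ} (ha : 3 / 8 ≤ a) (hd : 0 ≤ d) (had : a + 2 * d ≤ 1 / 2)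
    {g : Valuations → ℝ} (hg : Measurable g) (hg₁ : ∀ v, |g v| ≤ 1) :
    ∫ v, g v ∂(lawOf (perturbedDensity a d)) =
      (∫ v, g v ∂(lawOf baseDensity)) + ∫ v, perturbation a d v * g v := by
  rw [integral_lawOf (measurable_perturbedDensity a d) (perturbedDensity_nonneg ha hd had),
    integral_lawOf measurable_baseDensity baseDensity_nonneg,
    integral_perturbedDensity_mul a d hg hg₁]

theorem perturbed_regret {a d : ℝ} (ha : 3 / 8 ≤ a) (hd : 0 ≤ d) (had : a + 2 * d ≤ 1 / 2)
    (hd' : d ≤ 1 / 64) {m : unitInterval} (hm : (m : ℝ) = a + d) (x : Prices) :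
    d / 512 * (1 - (competitive a d).indicator (1 : Prices → ℝ) x) ≤
      ∫ v, (GFT (diag m) v - GFT x v) ∂(lawOf (perturbedDensity a d)) := by
  have := isProbabilityMeasure_perturbed ha hd had
  have h1 := integral_GFT_le_diag (lawOf (perturbedDensity a d)) x
  have h2 := integral_base_GFT_diag_le x.1.1 m ⟨by linarith, by linarith⟩
  rw [integral_perturbed ha hd had (measurable_GFT_right (diag x.1.1)) (abs_GFT_le _)] at h1
  rw [integral_sub_GFT, integral_perturbed ha hd had (measurable_GFT_right (diag m)) (abs_GFT_le _),
    integral_perturbation_GFT_diag_midpoint (by linarith) hd (by linarith) hm]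
  by_cases hx : x ∈ competitive a d
  · have h3 := integral_perturbation_GFT_diag_le (by linarith) hd (by linarith) hx
    rw [Set.indicator_of_mem hx]
    simp only [Pi.one_apply, sub_self, mul_zero]
    linarith
  · have h3 := integral_perturbation_GFT_diag_le_of_notMem (by linarith) hd (by linarith) hx
    rw [Set.indicator_of_notMem hx]
    -- The gap is at least `d/256 - d²/8`, and `d ≤ 1/64` makes the second term at most `d/512`.
    nlinarith

theorem perturbed_twoBit {a d : ℝ} (ha : 3 / 8 ≤ a) (hd : 0 ≤ d) (had : a + 2 * d ≤ 1 / 2) (x : Prices)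
    (z : Bool × Bool) : (lawOf (perturbedDensity a d)).real {v | twoBit x v = z} =
      (lawOf baseDensity).real {v | twoBit x v = z} +
        ∫ v, perturbation a d v * {v | twoBit x v = z}.indicator 1 v := by
  have hS := measurableSet_twoBit_eq x z
  rw [← integral_indicator_one hS, ← integral_indicator_one hS,
    integral_perturbed ha hd had (measurable_one.indicator hS) (abs_indicator_one_le _)]

/-! ### Tuning the strips and conclusion -/

/-- The left endpoint of the `k`-th of the strips of width `2 d` to the right of `3/8`. -/
noncomputable def stripStart (d : ℝ) (k : ℕ) : ℝ := 3 / 8 + 2 * d * k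

theorem le_stripStart {d : ℝ} (hd : 0 ≤ d) (k : ℕ) : 3 / 8 ≤ stripStart d k := by
  unfold stripStart
  have : 0 ≤ 2 * d * k := by positivity
  linarith

theorem stripStart_add_le {d : ℝ} (hd : 0 ≤ d) {k K : ℕ} (hk : k < K) :
    stripStart d k + 2 * d ≤ stripStart d K := by
  unfold stripStart
  have : (k : ℝ) + 1 ≤ K := by exact_mod_cast hk
  nlinarith

theorem sum_indicator_competitive_le {d : ℝ} (hd : 0 ≤ d) (K : ℕ) (x : Prices) :
    ∑ k : Fin K, (competitive (stripStart d k) d).indicator (1 : Prices → ℝ) x ≤ 1 := by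
  by_cases h : ∃ k : Fin K, x ∈ competitive (stripStart d k) d
  · obtain ⟨k, hk⟩ := h
    rw [Finset.sum_eq_single k, Set.indicator_of_mem hk, Pi.one_apply]
    · intro j _ hj
      refine Set.indicator_of_notMem (fun hj' => ?_) _
      have h1 : (x.1.1 : ℝ) ∈ Set.Ioc _ _ := hk
      have h2 : (x.1.1 : ℝ) ∈ Set.Ioc _ _ := hj'
      rcases lt_or_gt_of_ne (fun e => hj (Fin.ext e) : (j : ℕ) ≠ k) with h | h
      · linarith [stripStart_add_le hd h, h1.1, h2.2]
      · linarith [stripStart_add_le hd h, h2.1, h1.2]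
    · simp
  · push Not at h
    rw [Finset.sum_eq_zero fun k _ => Set.indicator_of_notMem (h k) _]
    exact zero_le_one

theorem base_regret_ge {q : unitInterval} (hq : (q : ℝ) ∈ Set.Icc (3 / 8) (5 / 8)) {d : ℝ}
    (hd : 0 ≤ d) {K : ℕ} (hK : stripStart d K ≤ 1 / 2) (x : Prices) :
    1 / 128 * ∑ k : Fin K, (informative (stripStart d k) d).indicator (1 : Prices → ℝ) x ≤
      ∫ v, (GFT (diag q) v - GFT x v) ∂(lawOf baseDensity) := by
  by_cases h : ∃ k : Fin K, x ∈ informative (stripStart d k) d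
  · obtain ⟨k, hk⟩ := h
    have h1 : ∑ k : Fin K, (informative (stripStart d k) d).indicator (1 : Prices → ℝ) x ≤ 1 :=
      (Finset.sum_le_sum fun k _ => Set.indicator_le_indicator_of_subset (fun _ h => h.1)
        (fun _ => zero_le_one) x).trans (sum_indicator_competitive_le hd K x)
    have h2 := base_regret_informative hq (le_stripStart hd k)
      ((stripStart_add_le hd k.isLt).trans hK) hk
    linarith
  · push Not at h
    rw [Finset.sum_eq_zero fun k _ => Set.indicator_of_notMem (h k) _, mul_zero]
    exact base_regret_nonneg hq x

theorem exists_iid_regret_ge {σ : ℝ} (hσ₀ : 0 < σ) (hσ : σ ≤ 1 / 9) {T : ℕ} (hT : 8008 ≤ T)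
    {Θ : Type*} [MeasurableSpace Θ] (A : Algorithm Θ) :
    ∃ (μ : Measure Valuations) (hμ : IsProbabilityMeasure μ) (hs : IsSmooth σ μ),
      (1 / 50 ^ 3 : ℝ) * (T : ℝ) ^ (3 / 4 : ℝ) ≤
        regret A (Adversary.iid (σ := σ) μ hμ hs) T := by
  -- Here `n = T^(1/4)`, and `9⁴ = 6561 < 8008`.
  obtain ⟨n, hn, hnT, hn3⟩ : ∃ n : ℝ, 9 ≤ n ∧ (T : ℝ) = n ^ 4 ∧
      (T : ℝ) ^ (3 / 4 : ℝ) = n ^ 3 := by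
    have hT' : (8008 : ℝ) ≤ T := by exact_mod_cast hT
    have h4 : ((T : ℝ) ^ (1 / 4 : ℝ)) ^ 4 = T := by
      rw [← Real.rpow_natCast, ← Real.rpow_mul (by linarith)]
      norm_num
    refine ⟨(T : ℝ) ^ (1 / 4 : ℝ), ?_, h4.symm, ?_⟩
    · by_contra! h
      have : ((T : ℝ) ^ (1 / 4 : ℝ)) ^ 4 < 9 ^ 4 :=
        pow_lt_pow_left₀ h (by positivity) (by norm_num)
      linarith
    · rw [← Real.rpow_natCast, ← Real.rpow_mul (by linarith)]
      norm_num
  rw [hn3]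
  set K := ⌈n⌉₊
  have hK1 : n ≤ K := Nat.le_ceil n
  have hK2 : (K : ℝ) ≤ 2 * n := by linarith [Nat.ceil_lt_add_one (show 0 ≤ n by linarith)]
  have hK0 : (0 : ℝ) < K := by linarith
  -- The `K` strips of width `2d` exactly fill `(3/8, 1/2]`.
  set d : ℝ := 1 / (16 * K) with hd_def
  have hdK : d * K = 1 / 16 := by rw [hd_def]; field_simp
  have hd : 0 ≤ d := by positivity
  have hd' : d ≤ 1 / 64 := by nlinarith
  have hstrip : stripStart d K ≤ 1 / 2 := by unfold stripStart; linarith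
  have ha : ∀ k : Fin K, 3 / 8 ≤ stripStart d k := fun k => le_stripStart hd k
  have had : ∀ k : Fin K, stripStart d k + 2 * d ≤ 1 / 2 := fun k =>
    (stripStart_add_le hd k.isLt).trans hstrip
  have hμ₀ := isProbabilityMeasure_base
  have hs₀ : IsSmooth σ (lawOf baseDensity) :=
    isSmooth_lawOf hσ₀ hσ fun v => (baseDensity_le v).trans (by norm_num)
  have hμ : ∀ k : Fin K, IsProbabilityMeasure (lawOf (perturbedDensity (stripStart d k) d)) :=
    fun k => isProbabilityMeasure_perturbed (ha k) hd (had k)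
  have hs : ∀ k : Fin K, IsSmooth σ (lawOf (perturbedDensity (stripStart d k) d)) := fun k =>
    isSmooth_lawOf hσ₀ hσ (perturbedDensity_le _ _)
  have hlik : ∀ k : Fin K, _ := fun k => exists_likelihoodRatio (μ₀ := lawOf baseDensity)
    (μ₁ := lawOf (perturbedDensity (stripStart d k) d))
    (measurableSet_informative (stripStart d k) d) (ε := d / 4) (by linarith)
    (fun x hx z => by
      rw [perturbed_twoBit (ha k) hd (had k), integral_perturbation_twoBit_of_notMem
        (by linarith [ha k]) hd (by linarith [had k]) hx, add_zero])
    (fun x hx z => base_twoBit_ge (ha k) (had k) hx z)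
    (fun x _ z => by
      rw [perturbed_twoBit (ha k) hd (had k), add_sub_cancel_left]
      exact abs_integral_perturbation_twoBit_le (by linarith [ha k]) hd (by linarith [had k]) x z)
  choose ℓ hℓ hℓ₀ hℓ₁ hℓμ hκ using hlik
  have hmid : ∀ k : Fin K, stripStart d k + d ∈ unitInterval := fun k =>
    ⟨by linarith [ha k], by linarith [had k]⟩
  obtain ⟨N, hN₀, hN₁⟩ := exists_exploration_tradeoff A hμ₀ hs₀ hμ hs hℓ hℓ₀ hℓ₁ hℓμ
    (fun k => measurableSet_informative (stripStart d k) d)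
    (fun k => measurableSet_competitive (stripStart d k) d)
    (sum_indicator_competitive_le hd K) (D := 256 * (d / 4) ^ 2) (by positivity) hκ
    (c := 1 / 128) (by norm_num) (diag ⟨1 / 2, by norm_num, by norm_num⟩)
    (base_regret_ge ⟨by norm_num, by norm_num⟩ hd hstrip) (Δ := d / 512) (by positivity)
    (fun k => diag ⟨stripStart d k + d, hmid k⟩)
    (fun k => perturbed_regret (ha k) hd (had k) hd' rfl) T
  -- The threshold balances `K` strips against about `1/d²`, of order `K²`, informative rounds
  -- needed for each.
  by_cases hN : N ≤ K ^ 3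
  · suffices h : ∃ k : Fin K, 1 / 50 ^ 3 * n ^ 3 ≤ regret A (Adversary.iid (σ := σ)
        (lawOf (perturbedDensity (stripStart d k) d)) (hμ k) (hs k)) T by
      obtain ⟨k, hk⟩ := h
      exact ⟨_, hμ k, hs k, hk⟩
    by_contra! h
    have h1 := Finset.sum_le_sum (s := Finset.univ) fun k (_ : k ∈ Finset.univ) => (h k).le
    simp only [Finset.sum_const, Finset.card_univ, Fintype.card_fin, nsmul_eq_mul] at h1
    have h2 : 4 * (256 * (d / 4) ^ 2) * N ≤ K / 4 := by
      calc 4 * (256 * (d / 4) ^ 2) * N ≤ 4 * (256 * (d / 4) ^ 2) * K ^ 3 :=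
            mul_le_mul_of_nonneg_left hN (by positivity)
        _ = 64 * (d * K) ^ 2 * K := by ring
        _ = K / 4 := by rw [hdK]; ring
    -- The bracket is at least `K/2 - 1`, which is at least `K/4` once `K ≥ 4`.
    have h3 : d / 512 * T * (K / 4) ≤
        d / 512 * T * (3 / 4 * K - 1 - 4 * (256 * (d / 4) ^ 2) * N) :=
      mul_le_mul_of_nonneg_left (by linarith) (by positivity)
    have h4 : d / 512 * T * (K / 4) = n ^ 4 / 32768 := by
      rw [hnT]
      linear_combination n ^ 4 / 2048 * hdK
    have h5 : (K : ℝ) * (1 / 50 ^ 3 * n ^ 3) ≤ 2 * n * (1 / 50 ^ 3 * n ^ 3) :=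
      mul_le_mul_of_nonneg_right hK2 (by positivity)
    have h6 : 0 < n ^ 4 := by positivity
    -- The contradiction is `n⁴ / 32768 ≤ 2 n⁴ / 50³ = n⁴ / 62500`.
    nlinarith
  · refine ⟨_, hμ₀, hs₀, le_trans ?_ hN₀⟩
    have h1 : n ^ 3 ≤ K ^ 3 := pow_le_pow_left₀ (by linarith) hK1 3
    have h2 : 0 < n ^ 3 := by positivity
    linarith

end BilateralTrade

theorem theorem3 (σ : ℝ) (hσ₀ : 0 < σ) (hσ : σ ≤ 1 / 9) (T : ℕ) (hT : 8008 ≤ T)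
    {Θ : Type*} [MeasurableSpace Θ] (A : BilateralTrade.Algorithm Θ) :
    (((1 / 50 ^ 3 : ℝ) * (T : ℝ) ^ (3 / 4 : ℝ) : ℝ) : EReal)
        ≤ BilateralTrade.worstCaseRegret A σ T ∧
    ∃ (μ : MeasureTheory.Measure BilateralTrade.Valuations)
      (hμ : MeasureTheory.IsProbabilityMeasure μ) (hs : BilateralTrade.IsSmooth σ μ),
      (1 / 50 ^ 3 : ℝ) * (T : ℝ) ^ (3 / 4 : ℝ)
        ≤ BilateralTrade.regret A (BilateralTrade.Adversary.iid (σ := σ) μ hμ hs) T := by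
  obtain ⟨μ, hμ, hs, h⟩ := BilateralTrade.exists_iid_regret_ge hσ₀ hσ hT A
  exact ⟨(EReal.coe_le_coe_iff.2 h).trans (le_iSup (fun S : BilateralTrade.Adversary Θ σ =>
    (BilateralTrade.regret A S T : EReal)) _), μ, hμ, hs, h⟩
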